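/- Let the scalar field $\mathbb{K}$ be $\mathbb{R}$ or $\mathbb{C}$. For a Banach space $X$ over $\mathbb{K}$ let $L(X)$ be the space of bounded linear operators on $X$ with the operator norm, $K(X)\subseteq L(X)$ the set of compact operators, and $\Pi(X)=\{(x,x^*)\in X\times X^*: \|x\|=\|x^*\|=x^*(x)=1\}$. The numerical radius of $T\in L(X)$ is $v(T)=\sup\{|x^*(Tx)|:(x,x^*)\in\Pi(X)\}$, and $\mathrm{NRA}(X)$ denotes the set of those $T\in L(X)$ for which this supremum is a maximum. $X$ has the approximation property if for every compact $C\subseteq X$ and every $\varepsilon>0$ there is a finite-rank $R\in L(X)$ with $\|x-Rx\|<\varepsilon$ for all $x\in C$. For Banach spaces $Y,Z$, let $Y\oplus_\infty Z$ be $Y\times Z$ with the norm $\|(y,z)\|=\max\{\|y\|,\|z\|\}$. Let $1<p<2$, let $M$ be a closed subspace of $\ell_p$, and suppose that the quotient $Y=\ell_p/M$, with the quotient norm (or any normed space $Y$ isometrically isomorphic to it), does not have the approximation property. Then there is a closed subspace $Z$ of $c_0$ such that $K(Y\oplus_\infty Z)$ is not contained in the norm closure of $\mathrm{NRA}(Y\oplus_\infty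 Z)$. More precisely, $Z$ can be chosen such that, in addition, there is a compact linear operator $S:Z\to Y$ which does not belong to the norm closure of the set of bounded finite-rank operators from $Z$ to $Y$, and for which the operator $T(y,z)=(S(z),0)$ on $Y\oplus_\infty Z$ is compact and does not belong to the norm closure of $\mathrm{NRA}(Y\oplus_\infty Z)$. -/

import Mathlib

set_option maxSynthPendingDepth 3

open scoped ENNReal ZeroAtInfty

section NumericalRadius

variable {𝕜 : Type*} [RCLike 𝕜]

/-- `Π(X)`: the pairs `(x, x*)` of norm-one vectors and norm-one functionals with `x*(x) = 1`. -/
def normingPairs (𝕜 : Type*) [RCLike 𝕜] (X : Type*) [NormedAddCommGroup X] [NormedSpace 𝕜 X] :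
    Set (X × StrongDual 𝕜 X) :=
  {q | ‖q.1‖ = 1 ∧ ‖q.2‖ = 1 ∧ q.2 q.1 = 1}

/-- The (spatial) numerical range `V(T)`. -/
def opNumericalRange {X : Type*} [NormedAddCommGroup X] [NormedSpace 𝕜 X] (T : X →L[𝕜] X) :
    Set 𝕜 :=
  {l | ∃ q ∈ normingPairs 𝕜 X, q.2 (T q.1) = l}

/-- The numerical radius `v(T)`. The set is bounded by `‖T‖`, and nonempty if `X ≠ 0`. -/
noncomputable def opNumericalRadius {X : Type*} [NormedAddCommGroup X] [NormedSpace 𝕜 X]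
    (T : X →L[𝕜] X) : ℝ :=
  sSup ((fun l : 𝕜 => ‖l‖) '' opNumericalRange T)

/-- `NRA(X)`: the operators for which the supremum defining the numerical radius is a maximum. -/
def numericalRadiusAttaining (𝕜 : Type*) [RCLike 𝕜] (X : Type*) [NormedAddCommGroup X]
    [NormedSpace 𝕜 X] : Set (X →L[𝕜] X) :=
  {T | ∃ l ∈ opNumericalRange T, ‖l‖ = opNumericalRadius T}

/-- The bounded linear operators of finite rank. -/
def finiteRankOperators (𝕜 : Type*) [RCLike 𝕜] (X Y : Type*) [NormedAddCommGroup X]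
    [NormedSpace 𝕜 X] [NormedAddCommGroup Y] [NormedSpace 𝕜 Y] : Set (X →L[𝕜] Y) :=
  {R | FiniteDimensional 𝕜 (LinearMap.range (R : X →ₗ[𝕜] Y))}

/-- The approximation property: on every compact set the identity is uniformly approximated by
bounded operators of finite rank. -/
def HasApproximationProperty (𝕜 : Type*) [RCLike 𝕜] (X : Type*) [NormedAddCommGroup X]
    [NormedSpace 𝕜 X] : Prop :=
  ∀ K : Set X, IsCompact K → ∀ ε : ℝ, 0 < ε →
    ∃ R ∈ finiteRankOperators 𝕜 X X, ∀ x ∈ K, ‖x - R x‖ < ε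

/-- For `S : Z → Y`, the operator `(y, z) ↦ (S z, 0)` on `Y ⊕_∞ Z`; the product `Y × Z` carries the
maximum norm. -/
noncomputable def liftToSum {Y Z : Type*} [NormedAddCommGroup Y] [NormedSpace 𝕜 Y]
    [NormedAddCommGroup Z] [NormedSpace 𝕜 Z] (S : Z →L[𝕜] Y) : (Y × Z) →L[𝕜] (Y × Z) :=
  (ContinuousLinearMap.inl 𝕜 Y Z).comp (S.comp (ContinuousLinearMap.snd 𝕜 Y Z))

end NumericalRadius

/-!
Write `T = liftToSum S`, and suppose that `Y` lacks the approximation property.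

*A compact operator that is not approximable.* Let `K ⊆ Y` be a compact set on which finite rank
operators do not approximate the identity. The unit ball of `Y*` is totally bounded for uniform
convergence on `K`; telescoping along finer and finer finite nets gives functionals `h m` on `Y`,
tending to zero uniformly on `K`, and weights `l m → 0` such that `‖y‖ ≤ 2 sup l m ‖h m y‖` on the
span of `K` (`exists_null_functionals_of_isCompact`). Then `y ↦ (h m y)` maps the span of `K` into
`c₀`; `Z` is the closure of its image and `S : Z → Y` extends the inverse map, which is compact
because of the weights. If `S` were close to a finite rank operator `R`, then extending `R` to `c₀`
and truncating the sequences `(h m x)`, uniformly small in their tails for `x ∈ K`, would give a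
finite rank operator on `Y` close to the identity on `K`
(`exists_compact_operator_not_mem_closure_finiteRank`).

*Smoothness of the dual norm.* The conjugate exponent `q` of `p` exceeds `2`, so on the dual of `ℓ_p`
the duality map, essentially `f ↦ (conj (f i) |f i| ^ (q - 2))`, is weakly differentiable along
lines. Norming vectors pass to quotients, so `Y` has a normalised duality map `j : Y* → Y` with the
same property away from zero (`exists_smoothDualityMap_quotient_lp`), and for `φ ≠ 0` the vector
`j φ` is the only one in the unit ball at which `φ` attains its norm
(`IsSmoothDualityMap.eq_of_apply_eq_norm`).

*Attainment forces finite rank.* Let `T'` be close to `T` and attain its numerical radius `v`. The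
value is attained at a pair `((y, z), (φ, 0))` with `y = j φ`, because functionals on the second
summand contribute almost nothing. If `A` and `B` are the components of `T'` from `Y` and `Z` to `Y`,
then `|φ (A (j φ) + B z)| = v`, while `|ψ (A (j ψ) + B z')| ≤ v ‖ψ‖` for all `ψ` and all `z'` in the
unit ball. As `z ∈ c₀`, for `w` in a subspace of finite codimension and of small norm all `z + c w`
with `|c| ≤ 1` lie in the unit ball. Perturbing `φ` to `φ + t u` and `z` to `z + c w` at the same
time gives `|t| |u (B w)| ≤ D t` with `D` differentiable at `0` and `D 0 = 0`. So `D` has a minimum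
at `0`, its derivative there vanishes, and `u (B w) = 0`. Hence `B w = 0` for all such `w`
(`IsSmoothDualityMap.apply_eq_zero_of_isMax`), and `B`, which is close to `S`, has finite rank
(`mem_finiteRankOperators_of_isMax`). This contradicts the choice of `S`.
-/

/-! ### Compact operators from subspaces of `c₀` and the approximation property -/

/-- A uniformly bounded family of functions on `ι` which, up to `δ`, is controlled by its values at
finitely many indices is totally bounded for the uniform norm. -/
theorem exists_finite_uniform_net {𝕜 α ι : Type*} [RCLike 𝕜] (a : α → ι → 𝕜) (s : Set α) {C : ℝ}
    (hC : ∀ g ∈ s, ∀ i, ‖a g i‖ ≤ C)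
    (hI : ∀ δ : ℝ, 0 < δ → ∃ I : Finset ι, ∀ i, ∃ j ∈ I, ∀ g ∈ s, ‖a g i - a g j‖ ≤ δ)
    {ε : ℝ} (hε : 0 < ε) :
    ∃ F : Set α, F ⊆ s ∧ F.Finite ∧ ∀ g ∈ s, ∃ g' ∈ F, ∀ i, ‖a g i - a g' i‖ ≤ ε := by
  rcases s.eq_empty_or_nonempty with rfl | ⟨g₀, hg₀⟩
  · exact ⟨∅, by simp, by simp, by simp⟩
  obtain ⟨I, hI⟩ := hI (ε / 3) (by positivity)
  let f : α → (I → 𝕜) := fun g j => a g j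
  have hb : Bornology.IsBounded (f '' s) := by
    refine isBounded_iff_forall_norm_le.2 ⟨max C 0, ?_⟩
    rintro _ ⟨g, hg, rfl⟩
    exact (pi_norm_le_iff_of_nonneg (le_max_right _ _)).2
      fun j => (hC g hg j).trans (le_max_left _ _)
  obtain ⟨t, hts, htf, ht⟩ := Metric.finite_approx_of_totallyBounded
    (hb.isCompact_closure.totallyBounded.subset subset_closure) (ε / 3) (by positivity)
  have : Nonempty α := ⟨g₀⟩
  have hex : ∀ y ∈ t, ∃ g ∈ s, f g = y := fun y hy => hts hy
  choose! r hr hfr using hex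
  refine ⟨r '' t, ?_, htf.image r, ?_⟩
  · rintro _ ⟨y, hy, rfl⟩
    exact hr y hy
  · intro g hg
    obtain ⟨y, hy, hgy⟩ := Set.mem_iUnion₂.1 (ht ⟨g, hg, rfl⟩)
    refine ⟨r y, ⟨y, hy, rfl⟩, fun i => ?_⟩
    obtain ⟨j, hj, hij⟩ := hI i
    have h1 := hij g hg
    have h2 := hij (r y) (hr y hy)
    have h3 : ‖a g j - a (r y) j‖ ≤ ε / 3 := by
      rw [Metric.mem_ball, dist_eq_norm, ← hfr y hy] at hgy
      exact (norm_le_pi_norm (f g - f (r y)) ⟨j, hj⟩).trans hgy.le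
    calc ‖a g i - a (r y) i‖
        = ‖(a g i - a g j) + (a g j - a (r y) j) - (a (r y) i - a (r y) j)‖ := by ring_nf
      _ ≤ ‖a g i - a g j‖ + ‖a g j - a (r y) j‖ + ‖a (r y) i - a (r y) j‖ :=
          (norm_sub_le _ _).trans (by gcongr; exact norm_add_le _ _)
      _ ≤ ε := by linarith

open Filter Topology in
/-- The functionals are multiples of differences of consecutive members of finite nets of the dual
unit ball, finer and finer for uniform convergence on `K`; a norming functional of `y` is the
telescoping sum of such differences on the span of `K`. -/
theorem exists_null_functionals_of_isCompact {𝕜 Y : Type*} [RCLike 𝕜] [NormedAddCommGroup Y]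
    [NormedSpace 𝕜 Y] {K : Set Y} (hK : IsCompact K) :
    ∃ (h : ℕ → StrongDual 𝕜 Y) (l : ℕ → ℝ) (C : ℝ), (∀ m, 0 ≤ l m) ∧ Tendsto l atTop (𝓝 0) ∧
      (∀ x ∈ K, ∀ m, ‖h m x‖ ≤ C * l m) ∧
      ∀ y ∈ Submodule.span 𝕜 K, ∀ s : ℝ, (∀ m, l m * ‖h m y‖ ≤ s) → ‖y‖ ≤ 2 * s := by
  obtain ⟨C, hC0, hC⟩ : ∃ C : ℝ, 0 < C ∧ ∀ x ∈ K, ‖x‖ ≤ C := by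
    obtain ⟨C, hC⟩ := hK.isBounded.exists_norm_le
    exact ⟨max C 1, by positivity, fun x hx => (hC x hx).trans (le_max_left _ _)⟩
  -- the unit ball of the dual is totally bounded for uniform convergence on `K`
  have net : ∀ ε : ℝ, 0 < ε → ∃ F : Set (StrongDual 𝕜 Y), F.Finite ∧
      ∀ g : StrongDual 𝕜 Y, ‖g‖ ≤ 1 → ∃ g' ∈ F, ∀ x ∈ K, ‖(g - g') x‖ ≤ ε := by
    intro ε hε
    obtain ⟨F, -, hF, hF'⟩ := exists_finite_uniform_net
      (fun (g : StrongDual 𝕜 Y) (x : K) => g x) (Metric.closedBall 0 1) (C := C)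
      (fun g hg x => by
        have h1 : ‖g‖ ≤ 1 := by simpa using hg
        exact (g.le_of_opNorm_le h1 x).trans (by simpa using hC x x.2))
      (fun δ hδ => by
        obtain ⟨t, htK, htf, ht⟩ :=
          Metric.finite_approx_of_totallyBounded hK.totallyBounded δ hδ
        have htf' : (Subtype.val ⁻¹' t : Set K).Finite :=
          htf.preimage Subtype.val_injective.injOn
        refine ⟨htf'.toFinset, fun x => ?_⟩
        obtain ⟨y, hy, hxy⟩ := Set.mem_iUnion₂.1 (ht x.2)
        refine ⟨⟨y, htK hy⟩, by simpa using hy, fun g hg => ?_⟩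
        have h1 : ‖g‖ ≤ 1 := by simpa using hg
        rw [Metric.mem_ball, dist_eq_norm] at hxy
        have h2 := g.le_of_opNorm_le h1 ((x : Y) - y)
        rw [map_sub] at h2
        simp only
        linarith)
      hε
    refine ⟨F, hF, fun g hg => ?_⟩
    obtain ⟨g', hg', h⟩ := hF' g (by simpa using hg)
    exact ⟨g', hg', fun x hx => by simpa using h ⟨x, hx⟩⟩
  -- at level `0` the radius is large enough for the net `{0}`, where the telescoping sum starts
  have net' : ∀ k : ℕ, ∃ F : Set (StrongDual 𝕜 Y), F.Finite ∧ (k = 0 → F = {0}) ∧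
      ∀ g : StrongDual 𝕜 Y, ‖g‖ ≤ 1 → ∃ g' ∈ F, ∀ x ∈ K, ‖(g - g') x‖ ≤ C * (1 / 8) ^ k := by
    intro k
    rcases Nat.eq_zero_or_pos k with rfl | hk
    · refine ⟨{0}, by simp, by simp, fun g hg => ⟨0, rfl, fun x hx => ?_⟩⟩
      simpa using (g.le_of_opNorm_le hg x).trans (by simpa using hC x hx)
    · obtain ⟨F, hF, hF'⟩ := net (C * (1 / 8) ^ k) (by positivity)
      exact ⟨F, hF, by omega, hF'⟩
  choose F hFf hF0 hF using net'
  -- adding `0` makes the index set below infinite, so that it can be enumerated by `ℕ`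
  let D : ℕ → Set (StrongDual 𝕜 Y) := fun k =>
    insert 0 {d | (∃ a ∈ F (k + 1), ∃ b ∈ F k, d = a - b) ∧
      ∀ x ∈ K, ‖d x‖ ≤ 2 * C * (1 / 8) ^ k}
  have hDf : ∀ k, (D k).Finite := by
    intro k
    refine Set.Finite.insert 0 (((hFf (k + 1)).image2 (fun a b => a - b) (hFf k)).subset ?_)
    rintro d ⟨⟨a, ha, b, hb, rfl⟩, -⟩
    exact ⟨a, ha, b, hb, rfl⟩
  have hDK : ∀ k, ∀ d ∈ D k, ∀ x ∈ K, ‖d x‖ ≤ 2 * C * (1 / 8) ^ k := by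
    rintro k d (rfl | hd) x hx
    · simpa using by positivity
    · exact hd.2 x hx
  have : ∀ k, Finite (D k) := fun k => (hDf k)
  have : Infinite (Σ k, D k) :=
    Infinite.of_injective (fun k => (⟨k, 0, Set.mem_insert _ _⟩ : Σ k, D k)) fun a b hab =>
      congrArg Sigma.fst hab
  obtain ⟨φ⟩ : Nonempty (ℕ ≃ Σ k, D k) := nonempty_equiv_of_countable
  -- radius `8 ^ (-k)`, factor `4 ^ k` and weight `2 ^ (-k)`: the functionals tend to zero on `K`, and
  -- the product `2 ^ k` of factor and weight makes the telescoping series summable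
  refine ⟨fun m => (4 : 𝕜) ^ (φ m).1 • ((φ m).2 : StrongDual 𝕜 Y), fun m => (1 / 2) ^ (φ m).1,
    2 * C, fun m => by positivity, ?_, ?_, ?_⟩
  · have h1 : Tendsto (Sigma.fst : (Σ k, D k) → ℕ) cofinite atTop := by
      rw [← Nat.cofinite_eq_atTop]
      refine Filter.Tendsto.cofinite_of_finite_preimage_singleton fun k => ?_
      refine (Set.finite_range (fun d : D k => (⟨k, d⟩ : Σ k, D k))).subset ?_
      rintro ⟨k', d⟩ rfl
      exact ⟨d, rfl⟩
    have h2 : Tendsto φ atTop cofinite := by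
      rw [← Nat.cofinite_eq_atTop]; exact φ.injective.tendsto_cofinite
    exact (tendsto_pow_atTop_nhds_zero_of_lt_one (by norm_num) (by norm_num)).comp (h1.comp h2)
  · intro x hx m
    have h1 := hDK _ _ (φ m).2.2 x hx
    have h2 : ‖(4 : 𝕜)‖ = 4 := by simp
    have h3 : (1 / 2 : ℝ) ^ (φ m).1 = 4 ^ (φ m).1 * (1 / 8) ^ (φ m).1 := by
      rw [← mul_pow]; norm_num
    simp only [smul_apply, norm_smul, norm_pow, h2]
    rw [h3]
    calc _ ≤ 4 ^ (φ m).1 * (2 * C * (1 / 8) ^ (φ m).1) := by gcongr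
      _ = _ := by ring
  · intro y hy s hs
    have key : ∀ k, ∀ d ∈ D k, ‖d y‖ ≤ (1 / 2) ^ k * s := by
      intro k d hd
      obtain ⟨m, hm⟩ := φ.surjective ⟨k, d, hd⟩
      have h1 : (1 / 2) ^ (φ m).1 * ‖((4 : 𝕜) ^ (φ m).1 • ((φ m).2 : StrongDual 𝕜 Y)) y‖ ≤ s :=
        hs m
      rw [hm] at h1
      have h2 : ‖(4 : 𝕜)‖ = 4 := by simp
      simp only [smul_apply, norm_smul, norm_pow, h2] at h1
      have h3 : (1 / 2 : ℝ) ^ k * (4 ^ k * ‖d y‖) = 2 ^ k * ‖d y‖ := by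
        rw [← mul_assoc, ← mul_pow]; norm_num
      have h4 : (1 / 2 : ℝ) ^ k * 2 ^ k = 1 := by rw [← mul_pow]; norm_num
      rw [h3] at h1
      calc ‖d y‖ = (1 / 2 : ℝ) ^ k * (2 ^ k * ‖d y‖) := by rw [← mul_assoc, h4, one_mul]
        _ ≤ _ := by gcongr
    have hs0 : 0 ≤ s := by simpa using (norm_nonneg _).trans (key 0 0 (Set.mem_insert _ _))
    obtain ⟨g, hg, hgy⟩ := exists_dual_vector'' 𝕜 y
    choose a haF ha using fun k => hF k g hg
    have hstep : ∀ k, a (k + 1) - a k ∈ D k := by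
      intro k
      refine Or.inr ⟨⟨_, haF _, _, haF _, rfl⟩, fun x hx => ?_⟩
      have h1 := ha k x hx
      have h2 := ha (k + 1) x hx
      have h3 : (a (k + 1) - a k) x = (g - a k) x - (g - a (k + 1)) x := by simp
      rw [h3]
      refine (norm_sub_le _ _).trans ?_
      have h4 : (1 / 8 : ℝ) ^ (k + 1) ≤ (1 / 8) ^ k :=
        pow_le_pow_of_le_one (by norm_num) (by norm_num) (Nat.le_succ k)
      nlinarith
    have hbound : ∀ n, ‖a n y‖ ≤ 2 * s - 2 * s * (1 / 2) ^ n := by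
      intro n
      induction n with
      | zero =>
        have h1 : a 0 = 0 := by simpa [hF0 0 rfl] using haF 0
        simp [h1]
      | succ n ih =>
        have h1 := key n _ (hstep n)
        have h2 : a (n + 1) y = a n y + (a (n + 1) - a n) y := by simp
        rw [h2]
        refine (norm_add_le _ _).trans ?_
        rw [pow_succ]
        linarith
    have hlim : ∀ x ∈ Submodule.span 𝕜 K, Tendsto (fun n => a n x) atTop (𝓝 (g x)) := by
      intro x hx
      induction hx using Submodule.span_induction with
      | mem x hx =>
        rw [tendsto_iff_norm_sub_tendsto_zero]
        refine squeeze_zero (fun _ => norm_nonneg _) (fun n => ?_)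
          (by simpa using (tendsto_pow_atTop_nhds_zero_of_lt_one (r := (1 / 8 : ℝ))
            (by norm_num) (by norm_num)).const_mul C)
        rw [norm_sub_rev]
        simpa using ha n x hx
      | zero => simp
      | add x y _ _ hx hy => simpa using hx.add hy
      | smul c x _ hx => simpa using hx.const_mul c
    have h1 : ‖g y‖ ≤ 2 * s := le_of_tendsto (hlim y hy).norm
      (Eventually.of_forall fun n => (hbound n).trans (by
        have : 0 ≤ 2 * s * (1 / 2) ^ n := by positivity
        linarith))
    simpa [hgy] using h1

theorem exists_extension_of_mem_finiteRankOperators {𝕜 E Y : Type*} [RCLike 𝕜]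
    [NormedAddCommGroup E] [NormedSpace 𝕜 E] [NormedAddCommGroup Y] [NormedSpace 𝕜 Y]
    {V : Submodule 𝕜 E} {R : V →L[𝕜] Y} (hR : R ∈ finiteRankOperators 𝕜 V Y) :
    ∃ R' : E →L[𝕜] Y, ∀ w : V, R w = R' w := by
  have : FiniteDimensional 𝕜 (LinearMap.range R.toLinearMap) := hR
  obtain ⟨R', hR'⟩ := R.exist_extension_of_finiteDimensional_range
  exact ⟨R', fun w => by rw [hR']; rfl⟩

theorem norm_apply_le_norm_c0 {𝕜 : Type*} [RCLike 𝕜] (f : C₀(ℕ, 𝕜)) (m : ℕ) : ‖f m‖ ≤ ‖f‖ :=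
  f.toBCF.norm_coe_le_norm m

theorem norm_c0_le {𝕜 : Type*} [RCLike 𝕜] {f : C₀(ℕ, 𝕜)} {c : ℝ} (hc : 0 ≤ c)
    (hf : ∀ m, ‖f m‖ ≤ c) : ‖f‖ ≤ c :=
  (f.toBCF.norm_le hc).2 hf

open Filter Topology in
/-- The unit vectors `δ i` of `c₀`, characterised by their finite linear combinations. -/
theorem exists_c0_truncation (𝕜 : Type*) [RCLike 𝕜] :
    ∃ δ : ℕ → C₀(ℕ, 𝕜), ∀ (c : ℕ → 𝕜) (M m : ℕ),
      (∑ i ∈ Finset.range M, c i • δ i) m = if m < M then c m else 0 := by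
  refine ⟨fun m => ⟨⟨Pi.single m 1, continuous_of_discreteTopology⟩, ?_⟩, fun c M m => ?_⟩
  · rw [Filter.cocompact_eq_cofinite, Nat.cofinite_eq_atTop]
    refine tendsto_const_nhds.congr' (eventually_atTop.2 ⟨m + 1, fun n hn => ?_⟩)
    have : n ≠ m := by omega
    simp [this]
  · induction M with
    | zero => simp
    | succ M ih =>
      rw [Finset.sum_range_succ, ZeroAtInftyContinuousMap.add_apply, ih,
        ZeroAtInftyContinuousMap.smul_apply, ZeroAtInftyContinuousMap.coe_mk]
      rcases lt_trichotomy m M with h | rfl | h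
      · simp [h, h.ne, h.trans (Nat.lt_succ_self M)]
      · simp
      · simp [h.ne', h.le.not_gt, show ¬ m < M + 1 by omega]

open Filter Topology in
/-- `S` is dominated by the diagonal operator with null weights `l`, which is compact on `c₀`. -/
theorem isCompactOperator_of_weighted_bound {𝕜 Y : Type*} [RCLike 𝕜] [NormedAddCommGroup Y]
    [NormedSpace 𝕜 Y] [CompleteSpace Y] {Z : Submodule 𝕜 C₀(ℕ, 𝕜)} {S : Z →L[𝕜] Y} {l : ℕ → ℝ}
    (hl0 : ∀ m, 0 ≤ l m) (hl : Tendsto l atTop (𝓝 0))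
    (hS : ∀ (z : Z) (s : ℝ), (∀ m, l m * ‖(z : C₀(ℕ, 𝕜)) m‖ ≤ s) → ‖S z‖ ≤ 2 * s) :
    IsCompactOperator S := by
  obtain ⟨L, hL⟩ : ∃ L, ∀ m, l m ≤ L := by
    obtain ⟨L, hL⟩ := hl.bddAbove_range
    exact ⟨L, fun m => hL ⟨m, rfl⟩⟩
  refine (isCompactOperator_iff_isCompact_closure_image_closedBall S.toLinearMap one_pos).2 ?_
  refine (TotallyBounded.closure ?_).isCompact_of_isClosed isClosed_closure
  refine Metric.totallyBounded_iff.2 fun δ hδ => ?_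
  have hball : ∀ z ∈ Metric.closedBall (0 : Z) 1, ∀ m,
      ‖(l m : 𝕜) * (z : C₀(ℕ, 𝕜)) m‖ ≤ l m := by
    intro z hz m
    have h1 : ‖(z : C₀(ℕ, 𝕜))‖ ≤ 1 := mem_closedBall_zero_iff.1 hz
    have h2 := (norm_apply_le_norm_c0 (z : C₀(ℕ, 𝕜)) m).trans h1
    rw [norm_mul, RCLike.norm_ofReal, abs_of_nonneg (hl0 m)]
    exact mul_le_of_le_one_right (hl0 m) h2
  have htail : ∀ η : ℝ, 0 < η → ∃ I : Finset ℕ, ∀ m, ∃ n ∈ I, ∀ z ∈ Metric.closedBall (0 : Z) 1,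
      ‖(l m : 𝕜) * (z : C₀(ℕ, 𝕜)) m - (l n : 𝕜) * (z : C₀(ℕ, 𝕜)) n‖ ≤ η := by
    intro η hη
    obtain ⟨N, hN⟩ := eventually_atTop.1 (hl.eventually_lt_const (half_pos hη))
    refine ⟨Finset.range (N + 1), fun m => ?_⟩
    rcases lt_or_ge m (N + 1) with hm | hm
    · exact ⟨m, Finset.mem_range.2 hm, fun z _ => by rw [sub_self, norm_zero]; exact hη.le⟩
    · refine ⟨N, Finset.mem_range.2 (Nat.lt_succ_self N), fun z hz => ?_⟩
      have h1 := (hball z hz m).trans (hN m (by omega)).le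
      have h2 := (hball z hz N).trans (hN N le_rfl).le
      exact (norm_sub_le _ _).trans (by linarith)
  obtain ⟨F, hFs, hFf, hF⟩ := exists_finite_uniform_net
    (fun (z : Z) (m : ℕ) => (l m : 𝕜) * (z : C₀(ℕ, 𝕜)) m) (Metric.closedBall 0 1)
    (fun z hz m => (hball z hz m).trans (hL m)) htail (show 0 < δ / 3 by positivity)
  refine ⟨S '' F, hFf.image _, ?_⟩
  rintro _ ⟨z, hz, rfl⟩
  obtain ⟨z', hz', hzz⟩ := hF z hz
  refine Set.mem_iUnion₂.2 ⟨S z', ⟨z', hz', rfl⟩, ?_⟩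
  have hle : ∀ m, l m * ‖((z - z' : Z) : C₀(ℕ, 𝕜)) m‖ ≤ δ / 3 := fun m => by
    have := hzz m
    rwa [← mul_sub, norm_mul, RCLike.norm_ofReal, abs_of_nonneg (hl0 m)] at this
  have hSz : ‖S z - S z'‖ ≤ 2 * (δ / 3) := by
    rw [← map_sub]
    exact hS (z - z') (δ / 3) hle
  change dist (S z) (S z') < δ
  rw [dist_eq_norm]
  linarith

open Filter Topology in
/-- Every compact set `K` lies in the image, under a compact operator `S`, of a closed subspace of
`c₀`; moreover the coordinates of the preimages are given by functionals on `Y` that tend to zero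
uniformly on `K`. -/
theorem exists_compact_operator_lifting {𝕜 Y : Type*} [RCLike 𝕜] [NormedAddCommGroup Y]
    [NormedSpace 𝕜 Y] [CompleteSpace Y] {K : Set Y} (hK : IsCompact K) :
    ∃ (h : ℕ → StrongDual 𝕜 Y) (l : ℕ → ℝ), Tendsto l atTop (𝓝 0) ∧
      (∀ x ∈ K, ∀ m, ‖h m x‖ ≤ l m) ∧
      ∃ Z : Submodule 𝕜 C₀(ℕ, 𝕜), IsClosed (Z : Set C₀(ℕ, 𝕜)) ∧ ∃ S : Z →L[𝕜] Y,
        IsCompactOperator S ∧ ∀ x ∈ K, ∃ w : Z, S w = x ∧ ∀ m, (w : C₀(ℕ, 𝕜)) m = h m x := by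
  obtain ⟨h, l, C, hl0, hl, hhK, hspan⟩ := exists_null_functionals_of_isCompact (𝕜 := 𝕜) hK
  -- the embedding of the span of `K` into `c₀`
  have hnull : ∀ x ∈ Submodule.span 𝕜 K, Tendsto (fun m => h m x) atTop (𝓝 0) := by
    intro x hx
    induction hx using Submodule.span_induction with
    | mem x hx => exact squeeze_zero_norm (fun m => hhK x hx m) (by simpa using hl.const_mul C)
    | zero => simp
    | add x y _ _ hx hy => simpa using hx.add hy
    | smul c x _ hx => simpa using hx.const_mul c
  let Φ : Submodule.span 𝕜 K →ₗ[𝕜] C₀(ℕ, 𝕜) :=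
    { toFun := fun x => ⟨⟨fun m => h m x, continuous_of_discreteTopology⟩, by
        simpa [Nat.cofinite_eq_atTop] using hnull x x.2⟩
      map_add' := fun x y => by ext m; simp
      map_smul' := fun c x => by ext m; simp }
  have hΦ : ∀ x m, Φ x m = h m x := fun x m => rfl
  let Z : Submodule 𝕜 C₀(ℕ, 𝕜) := (LinearMap.range Φ).topologicalClosure
  let Ψ : Submodule.span 𝕜 K →ₗ[𝕜] Z :=
    Φ.codRestrict Z fun x => Submodule.le_topologicalClosure _ ⟨x, rfl⟩
  have hΨ : DenseRange Ψ := by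
    refine Subtype.dense_iff.2 fun z hz => closure_mono ?_ hz
    rintro _ ⟨x, rfl⟩
    exact ⟨Ψ x, ⟨x, rfl⟩, rfl⟩
  obtain ⟨L, hL⟩ : ∃ L, ∀ m, l m ≤ L := by
    obtain ⟨L, hL⟩ := hl.bddAbove_range
    exact ⟨L, fun m => hL ⟨m, rfl⟩⟩
  have hL0 : 0 ≤ L := (hl0 0).trans (hL 0)
  have hbd : ∀ x, ‖(Submodule.span 𝕜 K).subtype x‖ ≤ (2 * L) * ‖Ψ x‖ := by
    intro x
    have := hspan x x.2 (L * ‖Ψ x‖) fun m =>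
      mul_le_mul (hL m) (norm_apply_le_norm_c0 (Φ x) m) (norm_nonneg _) hL0
    simpa [mul_assoc] using this
  let S : Z →L[𝕜] Y := (Submodule.span 𝕜 K).subtype.extendOfNorm Ψ
  have hS : ∀ x, S (Ψ x) = x := LinearMap.extendOfNorm_eq hΨ ⟨_, hbd⟩
  -- the basic inequality passes to the closure
  have hSbd : ∀ (z : Z) (s : ℝ), (∀ m, l m * ‖(z : C₀(ℕ, 𝕜)) m‖ ≤ s) → ‖S z‖ ≤ 2 * s := by
    intro z s hs
    refine le_of_forall_pos_le_add fun δ hδ => ?_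
    obtain ⟨x, hx⟩ := hΨ.exists_dist_lt z (show 0 < δ / (‖S‖ + 2 * L + 1) by positivity)
    rw [dist_eq_norm] at hx
    have h1 := hspan x x.2 (s + L * ‖z - Ψ x‖) fun m => by
      have e1 : ‖h m x‖ ≤ ‖(z : C₀(ℕ, 𝕜)) m‖ + ‖z - Ψ x‖ := by
        have := norm_apply_le_norm_c0 ((z - Ψ x : Z) : C₀(ℕ, 𝕜)) m
        have e2 : h m x = (z : C₀(ℕ, 𝕜)) m - ((z - Ψ x : Z) : C₀(ℕ, 𝕜)) m := by
          simp [Ψ, hΦ]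
        rw [e2]
        exact (norm_sub_le _ _).trans (by gcongr; exact this)
      calc l m * ‖h m x‖ ≤ l m * (‖(z : C₀(ℕ, 𝕜)) m‖ + ‖z - Ψ x‖) := by
            gcongr; exact hl0 m
        _ = l m * ‖(z : C₀(ℕ, 𝕜)) m‖ + l m * ‖z - Ψ x‖ := by ring
        _ ≤ _ := by gcongr; exacts [hs m, hL m]
    have h2 : ‖S z‖ ≤ ‖S‖ * ‖z - Ψ x‖ + ‖(x : Y)‖ := by
      calc ‖S z‖ = ‖S (z - Ψ x) + x‖ := by rw [map_sub, hS]; simp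
        _ ≤ _ := (norm_add_le _ _).trans (by gcongr; exact S.le_opNorm _)
    rw [lt_div_iff₀ (by positivity)] at hx
    have := norm_nonneg (z - Ψ x)
    nlinarith
  refine ⟨h, fun m => C * l m, by simpa using hl.const_mul C, hhK, Z,
    Submodule.isClosed_topologicalClosure _, S, ?_,
    fun x hx => ⟨Ψ ⟨x, Submodule.subset_span hx⟩, hS _, fun m => rfl⟩⟩
  exact isCompactOperator_of_weighted_bound hl0 hl hSbd

open Filter Topology in
/-- A finite rank operator close to `S`, composed with truncations of the coordinate functionals,
would approximate the identity of `Y` on the compact set that `S` covers. -/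
theorem exists_compact_operator_not_mem_closure_finiteRank {𝕜 Y : Type*} [RCLike 𝕜]
    [NormedAddCommGroup Y] [NormedSpace 𝕜 Y] [CompleteSpace Y]
    (hY : ¬ HasApproximationProperty 𝕜 Y) :
    ∃ Z : Submodule 𝕜 C₀(ℕ, 𝕜), IsClosed (Z : Set C₀(ℕ, 𝕜)) ∧ ∃ S : Z →L[𝕜] Y,
      IsCompactOperator S ∧ S ∉ closure (finiteRankOperators 𝕜 Z Y) := by
  unfold HasApproximationProperty at hY
  push Not at hY
  obtain ⟨K, hK, ε, hε, hKε⟩ := hY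
  obtain ⟨h, l, hl, hhK, Z, hZ, S, hScomp, hS⟩ := exists_compact_operator_lifting (𝕜 := 𝕜) hK
  refine ⟨Z, hZ, S, hScomp, fun hcl => ?_⟩
  obtain ⟨L, hL⟩ : ∃ L, ∀ m, l m ≤ L := by
    obtain ⟨L, hL⟩ := hl.bddAbove_range
    exact ⟨L, fun m => hL ⟨m, rfl⟩⟩
  obtain ⟨R, hR, hRS⟩ := Metric.mem_closure_iff.1 hcl (ε / (2 * (|L| + 1))) (by positivity)
  rw [dist_eq_norm] at hRS
  obtain ⟨R', hR'⟩ := exists_extension_of_mem_finiteRankOperators hR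
  obtain ⟨M, hM⟩ : ∃ M, ∀ m ≥ M, l m ≤ ε / (4 * (‖R'‖ + 1)) := by
    obtain ⟨N, hN⟩ := eventually_atTop.1 (hl.eventually_lt_const
      (show 0 < ε / (4 * (‖R'‖ + 1)) by positivity))
    exact ⟨N, fun m hm => (hN m hm).le⟩
  obtain ⟨δ, hδ⟩ := exists_c0_truncation 𝕜
  let Q : Y →L[𝕜] Y := ∑ m ∈ Finset.range M, (h m).smulRight (R' (δ m))
  have hQa : ∀ x, Q x = ∑ m ∈ Finset.range M, h m x • R' (δ m) := fun x => by simp [Q]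
  have hQ : Q ∈ finiteRankOperators 𝕜 Y Y := by
    have : FiniteDimensional 𝕜
        (Submodule.span 𝕜 ((fun m => R' (δ m)) '' (Finset.range M : Set ℕ))) :=
      FiniteDimensional.span_of_finite 𝕜 ((Finset.finite_toSet _).image _)
    refine Submodule.finiteDimensional_of_le
      (S₂ := Submodule.span 𝕜 ((fun m => R' (δ m)) '' (Finset.range M : Set ℕ))) ?_
    rintro _ ⟨x, rfl⟩
    change Q x ∈ _
    rw [hQa]
    exact Submodule.sum_mem _ fun m hm =>
      Submodule.smul_mem _ _ (Submodule.subset_span ⟨m, hm, rfl⟩)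
  obtain ⟨x, hx, hxε⟩ := hKε Q hQ
  refine absurd hxε (not_le.2 ?_)
  obtain ⟨w, hSw, hwm⟩ := hS x hx
  have hw : ‖w‖ ≤ |L| := norm_c0_le (abs_nonneg L) fun m => by
    change ‖(w : C₀(ℕ, 𝕜)) m‖ ≤ |L|
    rw [hwm]
    exact (hhK x hx m).trans ((hL m).trans (le_abs_self L))
  set tr : C₀(ℕ, 𝕜) := ∑ m ∈ Finset.range M, h m x • δ m with htr
  have hQx : Q x = R' tr := by
    rw [hQa, htr, map_sum]
    simp only [map_smul]
  have htail : ‖(w : C₀(ℕ, 𝕜)) - tr‖ ≤ ε / (4 * (‖R'‖ + 1)) := by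
    refine norm_c0_le (by positivity) fun m => ?_
    rw [ZeroAtInftyContinuousMap.sub_apply, hδ, hwm]
    split_ifs with hm
    · rw [sub_self, norm_zero]
      positivity
    · rw [sub_zero]
      exact (hhK x hx m).trans (hM m (not_lt.1 hm))
  have e1 : x - Q x = (S - R) w + R' ((w : C₀(ℕ, 𝕜)) - tr) := by
    rw [map_sub, hQx, ← hR', sub_apply, hSw]
    abel
  have e2 : ‖(S - R) w‖ ≤ ε / 2 := by
    calc ‖(S - R) w‖ ≤ ‖S - R‖ * ‖w‖ := ContinuousLinearMap.le_opNorm _ _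
      _ ≤ ε / (2 * (|L| + 1)) * (|L| + 1) := by gcongr; linarith
      _ = ε / 2 := by field_simp
  have e3 : ‖R' ((w : C₀(ℕ, 𝕜)) - tr)‖ ≤ ε / 4 := by
    calc _ ≤ ‖R'‖ * (ε / (4 * (‖R'‖ + 1))) := R'.le_opNorm_of_le htail
      _ ≤ (‖R'‖ + 1) * (ε / (4 * (‖R'‖ + 1))) := by gcongr; linarith
      _ = ε / 4 := by field_simp
  rw [e1]
  exact (norm_add_le _ _).trans_lt (by linarith)

/-! ### Smooth duality maps on quotients of `ℓ_p` -/

/-- `j` is a duality map from the dual of `X` to `X`: it sends every functional to a vector of the unit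
ball at which the functional attains its norm. It is smooth in the sense that it is weakly Gateaux
differentiable, along real lines, away from the zero functional. The value `j 0` may be any vector of
the unit ball. -/
structure IsSmoothDualityMap {𝕜 X : Type*} [RCLike 𝕜] [NormedAddCommGroup X] [NormedSpace 𝕜 X]
    (j : StrongDual 𝕜 X → X) : Prop where
  norm_le : ∀ φ, ‖j φ‖ ≤ 1
  apply_self : ∀ φ : StrongDual 𝕜 X, φ (j φ) = (‖φ‖ : 𝕜)
  differentiableAt : ∀ φ : StrongDual 𝕜 X, φ ≠ 0 → ∀ u ψ : StrongDual 𝕜 X,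
    DifferentiableAt ℝ (fun t : ℝ => ψ (j (φ + (t : 𝕜) • u))) 0

/-- The scalar function `s ↦ conj s * |s| ^ (q - 2)`, which is, up to a factor, the gradient of
`|s| ^ q`. Applied to the coefficients of a functional on `ℓ_p`, with `q` the conjugate exponent, it
gives a multiple of a norming vector. -/
noncomputable def powDual {𝕜 : Type*} [RCLike 𝕜] (q : ℝ) (s : 𝕜) : 𝕜 :=
  starRingEnd 𝕜 s * ((‖s‖ ^ (q - 2) : ℝ) : 𝕜)

section PowDual

variable {𝕜 : Type*} [RCLike 𝕜] {q : ℝ}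

theorem norm_powDual (hq : 2 < q) (s : 𝕜) : ‖powDual q s‖ = ‖s‖ ^ (q - 1) := by
  rw [powDual, norm_mul, RCLike.norm_conj, RCLike.norm_ofReal,
    abs_of_nonneg (Real.rpow_nonneg (norm_nonneg s) _)]
  rcases (norm_nonneg s).eq_or_lt with h | h
  · rw [← h, Real.zero_rpow (by linarith : q - 1 ≠ 0), zero_mul]
  · rw [show q - 1 = 1 + (q - 2) by ring, Real.rpow_add h, Real.rpow_one]

theorem powDual_mul_self (hq : 2 < q) (s : 𝕜) : powDual q s * s = ((‖s‖ ^ q : ℝ) : 𝕜) := by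
  rw [powDual, mul_right_comm, RCLike.conj_mul]
  rcases (norm_nonneg s).eq_or_lt with h | h
  · rw [← h, Real.zero_rpow (by linarith : q ≠ 0)]
    simp
  · rw [← RCLike.ofReal_pow, ← RCLike.ofReal_mul, ← Real.rpow_natCast, ← Real.rpow_add h]
    norm_num

/-- As `q > 2`, `powDual q` is differentiable also at its zero. The bound on the derivative gives the
summable majorant for `differentiableAt_tsum_powDual`. -/
theorem exists_hasDerivAt_powDual (hq : 2 < q) (f h : 𝕜) (t : ℝ) :
    ∃ d : 𝕜, HasDerivAt (fun τ : ℝ => powDual q (f + (τ : 𝕜) * h)) d t ∧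
      ‖d‖ ≤ (q - 1) * ‖f + (t : 𝕜) * h‖ ^ (q - 2) * ‖h‖ := by
  have hline : HasDerivAt (fun τ : ℝ => f + (τ : 𝕜) * h) h t := by
    have h1 : HasDerivAt (fun τ : ℝ => (τ : 𝕜)) 1 t := by
      simpa using (RCLike.ofRealCLM (K := 𝕜)).hasDerivAt (x := t)
    simpa using (h1.mul_const h).const_add f
  by_cases hs : f + (t : 𝕜) * h = 0
  · refine ⟨0, ?_, by
      have : 0 ≤ q - 1 := by linarith
      rw [norm_zero]
      positivity⟩
    have hf : ∀ τ : ℝ, f + (τ : 𝕜) * h = ((τ - t : ℝ) : 𝕜) * h := fun τ => by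
      have : f = -((t : 𝕜) * h) := eq_neg_of_add_eq_zero_left hs
      rw [this]; push_cast; ring
    rw [hasDerivAt_iff_tendsto]
    have hlim : Filter.Tendsto (fun τ : ℝ => ‖h‖ ^ (q - 1) * |τ - t| ^ (q - 2))
        (nhds t) (nhds 0) := by
      have : Filter.Tendsto (fun τ : ℝ => |τ - t|) (nhds t) (nhds 0) := by
        have : Continuous fun τ : ℝ => |τ - t| := by fun_prop
        simpa using this.tendsto t
      have h2 := (this.rpow_const (p := q - 2) (Or.inr (by linarith))).const_mul (‖h‖ ^ (q - 1))
      rwa [Real.zero_rpow (by linarith), mul_zero] at h2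
    refine squeeze_zero (fun τ => by positivity) (fun τ => ?_) hlim
    have h0 : powDual q (f + (t : 𝕜) * h) = 0 := by rw [hs]; simp [powDual]
    rw [h0, smul_zero, sub_zero, sub_zero, norm_powDual hq, hf, norm_mul, RCLike.norm_ofReal,
      Real.norm_eq_abs, Real.mul_rpow (abs_nonneg _) (norm_nonneg _)]
    rcases (abs_nonneg (τ - t)).eq_or_lt with h3 | h3
    · rw [← h3, inv_zero, zero_mul]
      positivity
    · rw [show q - 1 = 1 + (q - 2) by ring, Real.rpow_add h3, Real.rpow_one, ← mul_assoc,
        ← mul_assoc, inv_mul_cancel₀ h3.ne', one_mul, mul_comm]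
  · set s := f + (t : 𝕜) * h with hsdef
    have hpos : 0 < ‖s‖ := norm_pos_iff.2 hs
    have hr : DifferentiableAt ℝ (fun τ : ℝ => ‖f + (τ : 𝕜) * h‖) t :=
      hline.differentiableAt.norm 𝕜 hs
    obtain ⟨r, hr⟩ : ∃ r, HasDerivAt (fun τ : ℝ => ‖f + (τ : 𝕜) * h‖) r t := ⟨_, hr.hasDerivAt⟩
    have hrle : ‖r‖ ≤ ‖h‖ := by
      refine hr.le_of_lip' (norm_nonneg h) (Filter.Eventually.of_forall fun τ => ?_)
      refine (abs_norm_sub_norm_le _ _).trans (le_of_eq ?_)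
      rw [show f + (τ : 𝕜) * h - (f + (t : 𝕜) * h) = ((τ - t : ℝ) : 𝕜) * h by push_cast; ring,
        norm_mul, RCLike.norm_ofReal, mul_comm, Real.norm_eq_abs]
    have hpow := hr.rpow_const (p := q - 2) (Or.inl hpos.ne')
    have hpow' : HasDerivAt (fun τ : ℝ => ((‖f + (τ : 𝕜) * h‖ ^ (q - 2) : ℝ) : 𝕜))
        ((r * (q - 2) * ‖s‖ ^ (q - 2 - 1) : ℝ) : 𝕜) t := by
      exact (RCLike.ofRealCLM (K := 𝕜)).hasFDerivAt.comp_hasDerivAt t hpow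
    have hconj : HasDerivAt (fun τ : ℝ => starRingEnd 𝕜 (f + (τ : 𝕜) * h)) (starRingEnd 𝕜 h) t :=
      (RCLike.conjCLE (K := 𝕜)).toContinuousLinearMap.hasFDerivAt.comp_hasDerivAt t hline
    refine ⟨_, hconj.mul hpow', ?_⟩
    refine (norm_add_le _ _).trans ?_
    simp only [norm_mul, RCLike.norm_conj, RCLike.norm_ofReal, ← hsdef]
    have e1 : |‖s‖ ^ (q - 2)| = ‖s‖ ^ (q - 2) := abs_of_nonneg (by positivity)
    have e2 : |r * (q - 2) * ‖s‖ ^ (q - 2 - 1)| = |r| * (q - 2) * ‖s‖ ^ (q - 2 - 1) := by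
      rw [abs_mul, abs_mul, abs_of_nonneg (by linarith : 0 ≤ q - 2),
        abs_of_nonneg (Real.rpow_nonneg hpos.le _)]
    have e3 : ‖s‖ * ‖s‖ ^ (q - 2 - 1) = ‖s‖ ^ (q - 2) := by
      rw [show q - 2 = 1 + (q - 2 - 1) by ring, Real.rpow_add hpos, Real.rpow_one]
      ring_nf
    have e4 : ‖s‖ * (|r| * (q - 2) * ‖s‖ ^ (q - 2 - 1)) = |r| * ((q - 2) * ‖s‖ ^ (q - 2)) := by
      rw [← e3]; ring
    rw [e1, e2, e4]
    have e5 : |r| * ((q - 2) * ‖s‖ ^ (q - 2)) ≤ ‖h‖ * ((q - 2) * ‖s‖ ^ (q - 2)) := by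
      have : 0 ≤ q - 2 := by linarith
      gcongr
      exact hrle
    linarith

theorem mul_rpow_mul_le (hq : 2 < q) {a b c : ℝ} (ha : 0 ≤ a) (hb : 0 ≤ b) (hc : 0 ≤ c) :
    a * b ^ (q - 2) * c ≤ a ^ q + b ^ q + c ^ q := by
  set m := max a (max b c) with hm
  have h1 : a ≤ m := le_max_left _ _
  have h2 : b ≤ m := (le_max_left _ _).trans (le_max_right _ _)
  have h3 : c ≤ m := (le_max_right _ _).trans (le_max_right _ _)
  have hm0 : 0 ≤ m := ha.trans h1
  have e1 : a * b ^ (q - 2) * c ≤ m ^ q := by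
    have h4 : b ^ (q - 2) ≤ m ^ (q - 2) := Real.rpow_le_rpow hb h2 (by linarith)
    have h5 : m * m ^ (q - 2) * m = m ^ q := by
      rcases hm0.eq_or_lt with h | h
      · rw [← h, Real.zero_rpow (by linarith : q ≠ 0), mul_zero]
      · rw [show q = 1 + (q - 2) + 1 by ring, Real.rpow_add h, Real.rpow_add h, Real.rpow_one]
        ring_nf
    rw [← h5]
    gcongr
  have pa := Real.rpow_nonneg ha q
  have pb := Real.rpow_nonneg hb q
  have pc := Real.rpow_nonneg hc q
  have e2 : m ^ q ≤ a ^ q + b ^ q + c ^ q := by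
    rcases max_choice a (max b c) with h | h
    · rw [hm, h]; linarith
    · rcases max_choice b c with h' | h'
      · rw [hm, h, h']; linarith
      · rw [hm, h, h']; linarith
  exact e1.trans e2

theorem add_rpow_le_two_rpow_mul (hq : 2 < q) {a b : ℝ} (ha : 0 ≤ a) (hb : 0 ≤ b) :
    (a + b) ^ q ≤ 2 ^ q * (a ^ q + b ^ q) := by
  have h1 : a + b ≤ 2 * max a b := by linarith [le_max_left a b, le_max_right a b]
  have h2 : 0 ≤ max a b := ha.trans (le_max_left _ _)
  calc (a + b) ^ q ≤ (2 * max a b) ^ q := Real.rpow_le_rpow (by positivity) h1 (by linarith)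
    _ = 2 ^ q * (max a b) ^ q := Real.mul_rpow (by norm_num) h2
    _ ≤ _ := by
      gcongr
      have pa := Real.rpow_nonneg ha q
      have pb := Real.rpow_nonneg hb q
      rcases max_choice a b with h | h <;> rw [h] <;> linarith

theorem differentiableAt_tsum_powDual (hq : 2 < q) {f h k : ℕ → 𝕜}
    (hf : Summable fun i => ‖f i‖ ^ q) (hh : Summable fun i => ‖h i‖ ^ q)
    (hk : Summable fun i => ‖k i‖ ^ q) :
    DifferentiableAt ℝ (fun t : ℝ => ∑' i, powDual q (f i + (t : 𝕜) * h i) * k i) 0 := by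
  choose d hd hdle using fun i t => exists_hasDerivAt_powDual hq (f i) (h i) t
  have hu : Summable fun i => (q - 1) * (‖k i‖ * (‖f i‖ + ‖h i‖) ^ (q - 2) * ‖h i‖) := by
    refine Summable.mul_left _ (Summable.of_nonneg_of_le (fun i => by positivity)
      (fun i => mul_rpow_mul_le hq (norm_nonneg _) (by positivity) (norm_nonneg _)) ?_)
    refine (hk.add (Summable.of_nonneg_of_le (fun i => by positivity) (fun i =>
      add_rpow_le_two_rpow_mul hq (norm_nonneg _) (norm_nonneg _))
      ((hf.add hh).mul_left _))).add hh
  refine (hasDerivAt_tsum_of_isPreconnected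
    (g := fun i (t : ℝ) => powDual q (f i + (t : 𝕜) * h i) * k i)
    (g' := fun i t => d i t * k i) (t := Set.Ioo (-1) 1) (y₀ := 0) (y := 0) hu isOpen_Ioo
    isPreconnected_Ioo (fun i t _ => (hd i t).mul_const (k i)) (fun i t ht => ?_) (by simp) ?_
    (by simp)).differentiableAt
  · have h1 : ‖f i + (t : 𝕜) * h i‖ ≤ ‖f i‖ + ‖h i‖ := by
      refine (norm_add_le _ _).trans ?_
      rw [norm_mul, RCLike.norm_ofReal]
      gcongr
      exact mul_le_of_le_one_left (norm_nonneg _) (abs_le.2 ⟨ht.1.le, ht.2.le⟩)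
    have h2 : 0 ≤ q - 1 := by linarith
    calc ‖d i t * k i‖ = ‖d i t‖ * ‖k i‖ := norm_mul _ _
      _ ≤ (q - 1) * (‖f i‖ + ‖h i‖) ^ (q - 2) * ‖h i‖ * ‖k i‖ := by
        gcongr
        refine (hdle i t).trans ?_
        have := Real.rpow_le_rpow (norm_nonneg _) h1 (by linarith : 0 ≤ q - 2)
        gcongr
      _ = _ := by ring
  · refine Summable.of_norm_bounded ((hk.add hf).add hf) fun i => ?_
    have := mul_rpow_mul_le hq (norm_nonneg (k i)) (norm_nonneg (f i)) (norm_nonneg (f i))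
    refine le_trans (le_of_eq ?_) this
    rw [norm_mul, norm_powDual hq]
    simp only [RCLike.ofReal_zero, zero_mul, add_zero]
    rcases (norm_nonneg (f i)).eq_or_lt with h0 | h0
    · rw [← h0, Real.zero_rpow (by linarith : q - 1 ≠ 0)]; ring
    · rw [show q - 1 = q - 2 + 1 by ring, Real.rpow_add h0, Real.rpow_one]; ring

end PowDual

section LpDuality

variable {𝕜 : Type*} [RCLike 𝕜] {p : ℝ≥0∞} [Fact (1 ≤ p)] {q : ℝ}

theorem dual_lp_hasSum (hp : p ≠ ⊤) (φ : StrongDual 𝕜 (lp (fun _ : ℕ => 𝕜) p))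
    (x : lp (fun _ : ℕ => 𝕜) p) : HasSum (fun i => x i * φ (lp.single p i 1)) (φ x) := by
  have h := (lp.hasSum_single hp x).mapL φ
  have e : ∀ i, φ (lp.single p i (x i)) = x i * φ (lp.single p i 1) := fun i => by
    rw [← smul_eq_mul, ← map_smul, ← lp.single_smul, smul_eq_mul, mul_one]
  simpa only [e] using h

/-- The coefficients of a functional on `ℓ_p` form an element of `ℓ_q` of no larger norm: test the
functional on finite sections of its dual vector. -/
theorem dual_lp_summable (hpq : p.toReal.HolderConjugate q) (hq : 2 < q)
    (φ : StrongDual 𝕜 (lp (fun _ : ℕ => 𝕜) p)) :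
    Summable (fun i => ‖φ (lp.single p i 1)‖ ^ q) ∧
      ∑' i, ‖φ (lp.single p i 1)‖ ^ q ≤ ‖φ‖ ^ q := by
  have hp0 : 0 < p.toReal := hpq.pos
  set f : ℕ → 𝕜 := fun i => φ (lp.single p i 1) with hf
  have hsum : ∀ s : Finset ℕ, ∑ i ∈ s, ‖f i‖ ^ q ≤ ‖φ‖ ^ q := by
    intro s
    set S := ∑ i ∈ s, ‖f i‖ ^ q with hS
    have hS0 : 0 ≤ S := Finset.sum_nonneg fun i _ => by positivity
    set x : lp (fun _ : ℕ => 𝕜) p := ∑ i ∈ s, lp.single p i (powDual q (f i)) with hx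
    have hxn : ‖x‖ ^ p.toReal = S := by
      rw [hx, lp.norm_sum_single hp0 (fun i => powDual q (f i)) s, hS]
      refine Finset.sum_congr rfl fun i _ => ?_
      rw [norm_powDual hq, ← Real.rpow_mul (norm_nonneg _), hpq.symm.sub_one_mul_conj]
    have hφx : φ x = (S : 𝕜) := by
      rw [hx, map_sum, hS]
      push_cast
      refine Finset.sum_congr rfl fun i _ => ?_
      have : lp.single (E := fun _ : ℕ => 𝕜) p i (powDual q (f i))
          = powDual q (f i) • lp.single (E := fun _ : ℕ => 𝕜) p i (1 : 𝕜) := by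
        rw [← lp.single_smul, smul_eq_mul, mul_one]
      rw [this, map_smul, smul_eq_mul, powDual_mul_self hq]
    have hle : S ≤ ‖φ‖ * ‖x‖ := by
      have := φ.le_opNorm x
      rwa [hφx, RCLike.norm_ofReal, abs_of_nonneg hS0] at this
    rcases (norm_nonneg x).eq_or_lt with h0 | h0
    · rw [← h0, mul_zero] at hle
      exact hle.trans (by positivity)
    · have h1 : ‖x‖ ^ (p.toReal - 1) ≤ ‖φ‖ := by
        rw [← hxn, show p.toReal = p.toReal - 1 + 1 by ring, Real.rpow_add h0,
          Real.rpow_one] at hle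
        have := le_of_mul_le_mul_right hle h0
        simpa using this
      calc S = (‖x‖ ^ (p.toReal - 1)) ^ q := by
            rw [← hxn, ← Real.rpow_mul h0.le, hpq.sub_one_mul_conj]
        _ ≤ ‖φ‖ ^ q := Real.rpow_le_rpow (by positivity) h1 (by linarith)
  exact ⟨summable_of_sum_le (fun i => by positivity) hsum,
    Real.tsum_le_of_sum_le (fun i => by positivity) hsum⟩

theorem dual_lp_norm_rpow (hp : p ≠ ⊤) (hpq : p.toReal.HolderConjugate q) (hq : 2 < q)
    (φ : StrongDual 𝕜 (lp (fun _ : ℕ => 𝕜) p)) :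
    ∑' i, ‖φ (lp.single p i 1)‖ ^ q = ‖φ‖ ^ q := by
  have hp0 : 0 < p.toReal := hpq.pos
  obtain ⟨hs, hle⟩ := dual_lp_summable hpq hq φ
  refine le_antisymm hle ?_
  set S := ∑' i, ‖φ (lp.single p i 1)‖ ^ q
  have hS0 : 0 ≤ S := tsum_nonneg fun i => by positivity
  have h1 : ‖φ‖ ≤ S ^ (1 / q) := by
    refine φ.opNorm_le_bound (by positivity) fun x => ?_
    have hx : Summable fun i => ‖x i‖ ^ p.toReal := (lp.hasSum_norm hp0 x).summable
    have h2 := Real.summable_and_inner_le_Lp_mul_Lq_tsum_of_nonneg hpq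
      (fun i => norm_nonneg (x i)) (fun i => norm_nonneg (φ (lp.single p i 1))) hx hs
    have h3 : ‖φ x‖ ≤ ∑' i, ‖x i‖ * ‖φ (lp.single p i 1)‖ := by
      rw [← (dual_lp_hasSum hp φ x).tsum_eq]
      simp_rw [← norm_mul] at h2 ⊢
      exact norm_tsum_le_tsum_norm h2.1
    rw [lp.norm_eq_tsum_rpow hp0, mul_comm]
    exact h3.trans h2.2
  calc ‖φ‖ ^ q ≤ (S ^ (1 / q)) ^ q := Real.rpow_le_rpow (norm_nonneg _) h1 (by linarith)
    _ = S := by rw [← Real.rpow_mul hS0, one_div_mul_cancel (by linarith), Real.rpow_one]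

/-- The vector of `ℓ_p` with coordinates `powDual q (f i)`, where the `f i` are the coefficients of
`φ`, is a positive multiple of a norming vector of `φ`. -/
theorem exists_dual_lp_vector (hp : p ≠ ⊤) (hpq : p.toReal.HolderConjugate q) (hq : 2 < q)
    (φ : StrongDual 𝕜 (lp (fun _ : ℕ => 𝕜) p)) :
    ∃ X : lp (fun _ : ℕ => 𝕜) p, (∀ i, X i = powDual q (φ (lp.single p i 1))) ∧
      ‖X‖ = ‖φ‖ ^ (q - 1) ∧ φ X = ((‖φ‖ ^ q : ℝ) : 𝕜) := by
  have hp0 : 0 < p.toReal := hpq.pos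
  have hs := (dual_lp_summable hpq hq φ).1
  have hn : ∀ i, ‖powDual q (φ (lp.single p i 1))‖ ^ p.toReal = ‖φ (lp.single p i 1)‖ ^ q := by
    intro i
    rw [norm_powDual hq, ← Real.rpow_mul (norm_nonneg _), hpq.symm.sub_one_mul_conj]
  let X : lp (fun _ : ℕ => 𝕜) p := ⟨fun i => powDual q (φ (lp.single p i 1)),
    memℓp_gen (by simpa only [hn] using hs)⟩
  have hX : ∀ i, X i = powDual q (φ (lp.single p i 1)) := fun i => rfl
  refine ⟨X, hX, ?_, ?_⟩
  · rw [lp.norm_eq_tsum_rpow hp0]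
    simp_rw [hX, hn]
    rw [dual_lp_norm_rpow hp hpq hq, ← Real.rpow_mul (norm_nonneg _)]
    congr 1
    have := hpq.symm.sub_one_mul_conj
    field_simp
    linarith
  · refine (dual_lp_hasSum hp φ X).unique ?_
    simp_rw [hX, powDual_mul_self hq]
    rw [← dual_lp_norm_rpow hp hpq hq φ]
    exact hs.hasSum.mapL (RCLike.ofRealCLM (K := 𝕜))

theorem exists_smoothDualityMap_lp (hp₁ : 1 < p) (hp₂ : p < 2) :
    ∃ j : StrongDual 𝕜 (lp (fun _ : ℕ => 𝕜) p) → lp (fun _ : ℕ => 𝕜) p,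
      IsSmoothDualityMap j := by
  have hp : p ≠ ⊤ := (hp₂.trans (by simp)).ne
  have h1 : 1 < p.toReal := by
    simpa using (ENNReal.toReal_lt_toReal (by simp) hp).2 hp₁
  have h2 : p.toReal < 2 := by
    simpa using (ENNReal.toReal_lt_toReal hp (by simp)).2 hp₂
  set q := p.toReal.conjExponent with hqdef
  have hpq : p.toReal.HolderConjugate q := Real.HolderConjugate.conjExponent h1
  have hq : 2 < q := by
    have := hpq.sub_one_mul_conj
    nlinarith [hpq.symm.pos]
  choose X hX hXn hXφ using fun φ : StrongDual 𝕜 (lp (fun _ : ℕ => 𝕜) p) =>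
    exists_dual_lp_vector hp hpq hq φ
  refine ⟨fun φ => (((‖φ‖ ^ (q - 1))⁻¹ : ℝ) : 𝕜) • X φ, fun φ => ?_, fun φ => ?_,
    fun φ hφ u ψ => ?_⟩
  · rw [norm_smul, RCLike.norm_ofReal, hXn, abs_of_nonneg (by positivity)]
    exact inv_mul_le_one
  · rw [map_smul, hXφ, smul_eq_mul, ← RCLike.ofReal_mul]
    congr 1
    rcases (norm_nonneg φ).eq_or_lt with h0 | h0
    · rw [← h0, Real.zero_rpow (by linarith : q ≠ 0), mul_zero]
    · rw [show ‖φ‖ ^ q = ‖φ‖ ^ (q - 1) * ‖φ‖ by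
        rw [← Real.rpow_add_one h0.ne']; ring_nf, inv_mul_cancel_left₀ (by positivity)]
  · -- weak differentiability of the unnormalised duality map along a line
    have hXd : ∀ ψ : StrongDual 𝕜 (lp (fun _ : ℕ => 𝕜) p),
        DifferentiableAt ℝ (fun t : ℝ => ψ (X (φ + (t : 𝕜) • u))) 0 := by
      intro ψ
      have := differentiableAt_tsum_powDual hq (dual_lp_summable hpq hq φ).1
        (dual_lp_summable hpq hq u).1 (dual_lp_summable hpq hq ψ).1
      refine this.congr_of_eventuallyEq (Filter.Eventually.of_forall fun t => ?_)
      change ψ _ = _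
      rw [← (dual_lp_hasSum hp ψ _).tsum_eq]
      simp only [hX, add_apply, smul_apply, smul_eq_mul]
    have hofReal : DifferentiableAt ℝ (fun t : ℝ => (t : 𝕜)) 0 :=
      (RCLike.ofRealCLM (K := 𝕜)).differentiableAt
    -- `‖ψ‖ ^ q = ψ (X ψ)`, so differentiability of the norm follows from that of `X`
    have hN : DifferentiableAt ℝ (fun t : ℝ => ‖φ + (t : 𝕜) • u‖ ^ q) 0 := by
      have hd : DifferentiableAt ℝ (fun t : ℝ => RCLike.re (φ (X (φ + (t : 𝕜) • u)) +
          (t : 𝕜) * u (X (φ + (t : 𝕜) • u)))) 0 :=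
        (RCLike.reCLM (K := 𝕜)).differentiableAt.comp (0 : ℝ)
          ((hXd φ).add (hofReal.mul (hXd u)))
      refine hd.congr_of_eventuallyEq (Filter.Eventually.of_forall fun t => ?_)
      have := congrArg RCLike.re (hXφ (φ + (t : 𝕜) • u))
      rw [RCLike.ofReal_re] at this
      change ‖φ + (t : 𝕜) • u‖ ^ q = _
      rw [← this, add_apply, smul_apply, smul_eq_mul]
    have hN1 : DifferentiableAt ℝ (fun t : ℝ => ‖φ + (t : 𝕜) • u‖ ^ (q - 1)) 0 := by
      have h0 : ‖φ + ((0 : ℝ) : 𝕜) • u‖ ^ q ≠ 0 := by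
        have := norm_pos_iff.2 hφ
        simpa using (Real.rpow_pos_of_pos this q).ne'
      refine (hN.rpow_const (p := (q - 1) / q) (Or.inl h0)).congr_of_eventuallyEq
        (Filter.Eventually.of_forall fun t => ?_)
      change _ = (‖φ + (t : 𝕜) • u‖ ^ q) ^ ((q - 1) / q)
      rw [← Real.rpow_mul (norm_nonneg _), mul_div_cancel₀ _ (by linarith : q ≠ 0)]
    have h0 : ‖φ + ((0 : ℝ) : 𝕜) • u‖ ^ (q - 1) ≠ 0 := by
      have := norm_pos_iff.2 hφ
      simpa using (Real.rpow_pos_of_pos this (q - 1)).ne'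
    simp_rw [map_smul, smul_eq_mul]
    exact ((RCLike.ofRealCLM (K := 𝕜)).differentiableAt.comp (0 : ℝ) (hN1.inv h0)).mul (hXd ψ)

end LpDuality

/-- A quotient map of normed spaces has an isometric adjoint, so norming vectors of `φ ∘ π` are
mapped to norming vectors of `φ`. -/
theorem IsSmoothDualityMap.of_quotientMap {𝕜 X Y : Type*} [RCLike 𝕜] [NormedAddCommGroup X]
    [NormedSpace 𝕜 X] [NormedAddCommGroup Y] [NormedSpace 𝕜 Y]
    {j : StrongDual 𝕜 X → X} (hj : IsSmoothDualityMap j) (π : X →L[𝕜] Y) (hπ : ∀ x, ‖π x‖ ≤ ‖x‖)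
    (hlift : ∀ y, ∀ δ : ℝ, 0 < δ → ∃ x, π x = y ∧ ‖x‖ < ‖y‖ + δ) :
    IsSmoothDualityMap fun φ : StrongDual 𝕜 Y => π (j (φ.comp π)) := by
  have hnorm : ∀ φ : StrongDual 𝕜 Y, ‖φ.comp π‖ = ‖φ‖ := by
    intro φ
    refine le_antisymm (ContinuousLinearMap.opNorm_le_bound _ (norm_nonneg _) fun x =>
      (φ.le_opNorm _).trans (by gcongr; exact hπ x)) ?_
    refine φ.opNorm_le_bound (norm_nonneg _) fun y => ?_
    refine le_of_forall_pos_le_add fun δ hδ => ?_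
    obtain ⟨x, rfl, hx⟩ := hlift y (δ / (‖φ.comp π‖ + 1)) (by positivity)
    calc ‖φ (π x)‖ ≤ ‖φ.comp π‖ * ‖x‖ := (φ.comp π).le_opNorm x
      _ ≤ ‖φ.comp π‖ * (‖π x‖ + δ / (‖φ.comp π‖ + 1)) := by gcongr
      _ = ‖φ.comp π‖ * ‖π x‖ + ‖φ.comp π‖ * (δ / (‖φ.comp π‖ + 1)) := by ring
      _ ≤ ‖φ.comp π‖ * ‖π x‖ + (‖φ.comp π‖ + 1) * (δ / (‖φ.comp π‖ + 1)) := by gcongr; linarith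
      _ = ‖φ.comp π‖ * ‖π x‖ + δ := by field_simp
  refine ⟨fun φ => (hπ _).trans (hj.norm_le _), fun φ => ?_, fun φ hφ u ψ => ?_⟩
  · rw [← hnorm]
    exact hj.apply_self (φ.comp π)
  · have h0 : φ.comp π ≠ 0 := by
      rw [← norm_ne_zero_iff, hnorm]
      exact norm_ne_zero_iff.2 hφ
    exact hj.differentiableAt (φ.comp π) h0 (u.comp π) (ψ.comp π)

theorem exists_smoothDualityMap_quotient_lp {𝕜 : Type*} [RCLike 𝕜] {p : ℝ≥0∞} [Fact (1 ≤ p)]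
    (hp₁ : 1 < p) (hp₂ : p < 2) (M : Submodule 𝕜 (lp (fun _ : ℕ => 𝕜) p))
    [IsClosed (M : Set (lp (fun _ : ℕ => 𝕜) p))]
    {Y : Type*} [NormedAddCommGroup Y] [NormedSpace 𝕜 Y]
    (e : Y ≃ₗᵢ[𝕜] (lp (fun _ : ℕ => 𝕜) p ⧸ M)) :
    ∃ j : StrongDual 𝕜 Y → Y, IsSmoothDualityMap j := by
  obtain ⟨j, hj⟩ := exists_smoothDualityMap_lp (𝕜 := 𝕜) hp₁ hp₂
  have hπ : ∀ x, ‖e.symm (M.mkQ x)‖ ≤ ‖x‖ := fun x => by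
    rw [e.symm.norm_map]
    exact Submodule.Quotient.norm_mk_le M x
  refine ⟨_, hj.of_quotientMap
    ((e.symm.toLinearEquiv.toLinearMap ∘ₗ M.mkQ).mkContinuous 1 fun x => by
      simpa using hπ x) hπ fun y δ hδ => ?_⟩
  obtain ⟨x, hx, hxn⟩ := Submodule.Quotient.norm_mk_lt (e y) hδ
  refine ⟨x, ?_, by simpa using hxn⟩
  change e.symm (Submodule.Quotient.mk x) = y
  rw [hx, e.symm_apply_apply]

/-! ### Maximal values and finite rank -/

theorem exists_rotation {𝕜 : Type*} [RCLike 𝕜] (a b : 𝕜) :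
    ∃ c : 𝕜, ‖c‖ ≤ 1 ∧ ‖a + c * b‖ = ‖a‖ + ‖b‖ := by
  by_cases ha : a = 0
  · exact ⟨1, by simp, by simp [ha]⟩
  by_cases hb : b = 0
  · exact ⟨1, by simp, by simp [hb]⟩
  have ha' : (‖a‖ : 𝕜) ≠ 0 := by simpa using ha
  have hb' : ‖b‖ ≠ 0 := by simpa using hb
  have ha'' : ‖a‖ ≠ 0 := by simpa using ha
  refine ⟨a / ‖a‖ * (‖b‖ / b), ?_, ?_⟩
  · simp [ha'', hb']
  · have : a + a / ‖a‖ * (‖b‖ / b) * b = a / ‖a‖ * ((‖a‖ + ‖b‖ : ℝ) : 𝕜) := by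
      push_cast
      field_simp
    rw [this, norm_mul, norm_div, RCLike.norm_ofReal, RCLike.norm_ofReal, abs_norm, div_self ha'',
      one_mul, abs_of_nonneg (by positivity)]

section DualityMap

variable {𝕜 Y : Type*} [RCLike 𝕜] [NormedAddCommGroup Y] [NormedSpace 𝕜 Y]
  {j : StrongDual 𝕜 Y → Y}

/-- At a point of differentiability of the dual norm the norming vector is unique. -/
theorem IsSmoothDualityMap.eq_of_apply_eq_norm (hj : IsSmoothDualityMap j) {φ : StrongDual 𝕜 Y}
    (hφ : φ ≠ 0) {y : Y} (hy : ‖y‖ ≤ 1) (hφy : φ y = (‖φ‖ : 𝕜)) : y = j φ := by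
  have key : ∀ u : StrongDual 𝕜 Y, RCLike.re (u y) = RCLike.re (u (j φ)) := by
    intro u
    set g : ℝ → ℝ := fun t => RCLike.re (u (j (φ + (t : 𝕜) • u))) with hg
    have hgc : ContinuousAt g 0 :=
      RCLike.continuous_re.continuousAt.comp (hj.differentiableAt φ hφ u u).continuousAt
    -- compare the norm of `φ + t u` at `y` and at its own norming vector
    have hle : ∀ t : ℝ, t * RCLike.re (u y) ≤ t * g t := by
      intro t
      have h1 : RCLike.re ((φ + (t : 𝕜) • u) y) ≤ ‖φ + (t : 𝕜) • u‖ := by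
        refine (RCLike.re_le_norm _).trans (((φ + (t : 𝕜) • u).le_opNorm y).trans ?_)
        exact mul_le_of_le_one_right (norm_nonneg _) hy
      have h2 : RCLike.re ((φ + (t : 𝕜) • u) (j (φ + (t : 𝕜) • u))) = ‖φ + (t : 𝕜) • u‖ := by
        rw [hj.apply_self, RCLike.ofReal_re]
      have h3 : RCLike.re (φ (j (φ + (t : 𝕜) • u))) ≤ ‖φ‖ := by
        refine (RCLike.re_le_norm _).trans ((φ.le_opNorm _).trans ?_)
        exact mul_le_of_le_one_right (norm_nonneg _) (hj.norm_le _)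
      rw [← h2] at h1
      simp only [add_apply, smul_apply, smul_eq_mul, map_add, RCLike.re_ofReal_mul, hφy,
        RCLike.ofReal_re] at h1
      simp only [hg]
      linarith
    have hg0 : g 0 = RCLike.re (u (j φ)) := by simp [hg]
    rw [← hg0]
    refine le_antisymm ?_ ?_
    · refine ge_of_tendsto (hgc.tendsto.mono_left (nhdsWithin_le_nhds (s := Set.Ioi 0))) ?_
      filter_upwards [self_mem_nhdsWithin] with t ht
      exact le_of_mul_le_mul_left (hle t) ht
    · refine le_of_tendsto (hgc.tendsto.mono_left (nhdsWithin_le_nhds (s := Set.Iio 0))) ?_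
      filter_upwards [self_mem_nhdsWithin] with t ht
      exact (mul_le_mul_left_of_neg ht).1 (hle t)
  refine (SeparatingDual.eq_iff_forall_dual_eq (R := 𝕜)).2 fun u => ?_
  refine RCLike.ext (key u) ?_
  have := key ((RCLike.I : 𝕜) • u)
  simpa [RCLike.mul_re] using this

theorem eq_zero_of_mul_abs_le {D : ℝ → ℝ} {c : ℝ} (hc : 0 ≤ c) (hD : DifferentiableAt ℝ D 0)
    (hD0 : D 0 = 0) (hle : ∀ t, c * |t| ≤ D t) : c = 0 := by
  have hmin : IsLocalMin D 0 := Filter.Eventually.of_forall fun t => by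
    rw [hD0]; exact (by positivity : 0 ≤ c * |t|).trans (hle t)
  have hd : HasDerivAt D 0 0 := by
    have := hD.hasDerivAt
    rwa [hmin.deriv_eq_zero] at this
  have hs := hd.tendsto_slope_zero_right
  refine le_antisymm (ge_of_tendsto hs ?_) hc
  filter_upwards [self_mem_nhdsWithin] with t ht
  have ht' : (0 : ℝ) < t := ht
  have := hle t
  rw [abs_of_pos ht'] at this
  rw [zero_add, hD0, sub_zero, smul_eq_mul, inv_mul_eq_div, le_div_iff₀ ht']
  exact this

/-- The second-order argument: if `(φ, z)` maximises `|φ (A (j φ) + B z)|` and `z` is the centre of a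
disc in direction `w` inside the unit ball, then `B w = 0`. The first-order gain `|t| |u (B w)|` from
perturbing `φ` and `z` at the same time is not compensated, since the rest is differentiable. -/
theorem IsSmoothDualityMap.apply_eq_zero_of_isMax {Z : Type*} [NormedAddCommGroup Z]
    [NormedSpace 𝕜 Z] (hj : IsSmoothDualityMap j) (A : Y →L[𝕜] Y) (B : Z →L[𝕜] Y) {v : ℝ}
    (hv : 0 < v)
    (hmax : ∀ φ : StrongDual 𝕜 Y, ∀ z : Z, ‖z‖ ≤ 1 → ‖φ (A (j φ) + B z)‖ ≤ v * ‖φ‖)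
    {φ : StrongDual 𝕜 Y} (hφ : ‖φ‖ = 1) {z : Z} (hφz : ‖φ (A (j φ) + B z)‖ = v) {w : Z}
    (hw : ∀ c : 𝕜, ‖c‖ ≤ 1 → ‖z + c • w‖ ≤ 1) : B w = 0 := by
  have hφ0 : φ ≠ 0 := by rintro rfl; simp at hφ
  -- rotating `w` turns the maximality into an estimate for a sum of moduli
  have hsum : ∀ ψ : StrongDual 𝕜 Y, ‖ψ (A (j ψ) + B z)‖ + ‖ψ (B w)‖ ≤ v * ‖ψ‖ := by
    intro ψ
    obtain ⟨c, hc, hc'⟩ := exists_rotation (ψ (A (j ψ) + B z)) (ψ (B w))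
    have := hmax ψ (z + c • w) (hw c hc)
    rw [map_add B, map_smul B, ← add_assoc, map_add ψ, map_smul ψ, smul_eq_mul, hc'] at this
    exact this
  -- at `ψ = φ` the first term is already maximal
  have hφw : φ (B w) = 0 := by
    have := hsum φ
    rw [hφz, hφ] at this
    exact norm_le_zero_iff.1 (by linarith)
  refine (SeparatingDual.eq_zero_iff_forall_dual_eq_zero (R := 𝕜) _).2 fun u => ?_
  have hline : ∀ ψ : StrongDual 𝕜 Y, DifferentiableAt ℝ
      (fun t : ℝ => ψ (j (φ + (t : 𝕜) • u))) 0 := hj.differentiableAt φ hφ0 u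
  have hofReal : DifferentiableAt ℝ (fun t : ℝ => (t : 𝕜)) 0 :=
    (RCLike.ofRealCLM (K := 𝕜)).differentiableAt
  -- `‖ψ‖ = ψ (j ψ)`
  have hN : DifferentiableAt ℝ (fun t : ℝ => ‖φ + (t : 𝕜) • u‖) 0 := by
    refine ((RCLike.reCLM (K := 𝕜)).differentiableAt.comp (0 : ℝ)
      ((hline φ).add (hofReal.mul (hline u)))).congr_of_eventuallyEq
      (Filter.Eventually.of_forall fun t => ?_)
    have := congrArg RCLike.re (hj.apply_self (φ + (t : 𝕜) • u))
    rw [RCLike.ofReal_re] at this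
    change ‖φ + (t : 𝕜) • u‖ = _
    rw [← this]
    rfl
  have hG : DifferentiableAt ℝ
      (fun t : ℝ => (φ + (t : 𝕜) • u) (A (j (φ + (t : 𝕜) • u)) + B z)) 0 := by
    refine (((hline (φ.comp A)).add_const (φ (B z))).add
      (hofReal.mul ((hline (u.comp A)).add_const (u (B z))))).congr_of_eventuallyEq
      (Filter.Eventually.of_forall fun t => ?_)
    change φ (A _ + B z) + (t : 𝕜) * u (A _ + B z) = _
    rw [map_add, map_add]
    rfl
  have hG0 : ‖(φ + ((0 : ℝ) : 𝕜) • u) (A (j (φ + ((0 : ℝ) : 𝕜) • u)) + B z)‖ = v := by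
    simpa using hφz
  have hD : DifferentiableAt ℝ (fun t : ℝ => v * ‖φ + (t : 𝕜) • u‖ -
      ‖(φ + (t : 𝕜) • u) (A (j (φ + (t : 𝕜) • u)) + B z)‖) 0 :=
    (hN.const_mul v).sub (hG.norm 𝕜 (norm_ne_zero_iff.1 (by rw [hG0]; exact hv.ne')))
  refine norm_eq_zero.1 (eq_zero_of_mul_abs_le (norm_nonneg _) hD ?_ fun t => ?_)
  · simp only [hG0]
    simp [hφ]
  · have := hsum (φ + (t : 𝕜) • u)
    have e : ‖(φ + (t : 𝕜) • u) (B w)‖ = ‖u (B w)‖ * |t| := by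
      rw [add_apply, hφw, zero_add, smul_apply, smul_eq_mul, norm_mul, RCLike.norm_ofReal, mul_comm]
    rw [e] at this
    linarith

end DualityMap

theorem mem_finiteRankOperators_of_ker_le {𝕜 Y Z V : Type*} [RCLike 𝕜] [NormedAddCommGroup Y]
    [NormedSpace 𝕜 Y] [NormedAddCommGroup Z] [NormedSpace 𝕜 Z] [AddCommGroup V] [Module 𝕜 V]
    [FiniteDimensional 𝕜 V] (B : Z →L[𝕜] Y) (ev : Z →ₗ[𝕜] V)
    (h : ∀ z, ev z = 0 → B z = 0) : B ∈ finiteRankOperators 𝕜 Z Y := by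
  have hle : LinearMap.ker ev ≤ LinearMap.ker (B : Z →ₗ[𝕜] Y) := fun z hz => h z hz
  have : FiniteDimensional 𝕜 (Z ⧸ LinearMap.ker ev) :=
    ev.quotKerEquivRange.symm.finiteDimensional
  have e := Submodule.range_liftQ (LinearMap.ker ev) (B : Z →ₗ[𝕜] Y) hle
  change FiniteDimensional 𝕜 (LinearMap.range (B : Z →ₗ[𝕜] Y))
  rw [← e]
  infer_instance

open Filter Topology in
/-- All but finitely many coordinates of `z ∈ c₀` have modulus less than `1 / 2`, so `z` can be moved
inside the unit ball along a subspace of finite codimension. -/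
theorem mem_finiteRankOperators_of_isMax {𝕜 Y : Type*} [RCLike 𝕜] [NormedAddCommGroup Y]
    [NormedSpace 𝕜 Y] {j : StrongDual 𝕜 Y → Y} (hj : IsSmoothDualityMap j)
    {Z : Submodule 𝕜 C₀(ℕ, 𝕜)} (A : Y →L[𝕜] Y) (B : Z →L[𝕜] Y) {v : ℝ} (hv : 0 < v)
    (hmax : ∀ φ : StrongDual 𝕜 Y, ∀ z : Z, ‖z‖ ≤ 1 → ‖φ (A (j φ) + B z)‖ ≤ v * ‖φ‖)
    {φ : StrongDual 𝕜 Y} (hφ : ‖φ‖ = 1) {z : Z} (hz : ‖z‖ ≤ 1)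
    (hφz : ‖φ (A (j φ) + B z)‖ = v) : B ∈ finiteRankOperators 𝕜 Z Y := by
  have hnull : Tendsto (fun m => (z : C₀(ℕ, 𝕜)) m) atTop (𝓝 0) := by
    have := (z : C₀(ℕ, 𝕜)).zero_at_infty'
    rwa [Filter.cocompact_eq_cofinite, Nat.cofinite_eq_atTop] at this
  obtain ⟨N, hN⟩ := eventually_atTop.1
    (hnull.norm.eventually_lt_const (show ‖(0 : 𝕜)‖ < 1 / 2 by simp))
  let ev : Z →ₗ[𝕜] (Fin N → 𝕜) :=
    { toFun := fun w m => (w : C₀(ℕ, 𝕜)) m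
      map_add' := fun _ _ => rfl
      map_smul' := fun _ _ => rfl }
  -- on the kernel of `ev` one can perturb `z` inside the unit ball
  refine mem_finiteRankOperators_of_ker_le B ev fun w hw => ?_
  by_cases hw0 : w = 0
  · rw [hw0, map_zero]
  have hwn : ‖w‖ ≠ 0 := norm_ne_zero_iff.2 hw0
  have hwm : ∀ m < N, (w : C₀(ℕ, 𝕜)) m = 0 := fun m hm => congrFun hw ⟨m, hm⟩
  have hzn : ‖(z : C₀(ℕ, 𝕜))‖ ≤ 1 := hz
  set a : 𝕜 := ((1 / (2 * ‖w‖) : ℝ) : 𝕜) with ha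
  have han : ‖a‖ * ‖(w : C₀(ℕ, 𝕜))‖ = 1 / 2 := by
    change ‖a‖ * ‖w‖ = 1 / 2
    rw [ha, RCLike.norm_ofReal, abs_of_nonneg (by positivity)]
    field_simp
  have ha0 : a ≠ 0 := by
    rintro h0
    rw [h0] at han
    norm_num at han
  have := hj.apply_eq_zero_of_isMax A B hv hmax hφ hφz (w := a • w) fun c hc => by
    refine norm_c0_le (f := (z : C₀(ℕ, 𝕜)) + c • a • (w : C₀(ℕ, 𝕜))) zero_le_one fun m => ?_
    change ‖(z : C₀(ℕ, 𝕜)) m + c * (a * (w : C₀(ℕ, 𝕜)) m)‖ ≤ 1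
    rcases lt_or_ge m N with hm | hm
    · rw [hwm m hm, mul_zero, mul_zero, add_zero]
      exact (norm_apply_le_norm_c0 _ m).trans hzn
    · have h1 : ‖c * (a * (w : C₀(ℕ, 𝕜)) m)‖ ≤ 1 / 2 := by
        rw [norm_mul, norm_mul, ← han]
        refine (mul_le_of_le_one_left (by positivity) hc).trans ?_
        gcongr
        exact norm_apply_le_norm_c0 _ m
      exact (norm_add_le _ _).trans (by linarith [hN m hm])
  rw [map_smul] at this
  exact (smul_eq_zero.1 this).resolve_left ha0

/-! ### Numerical radius attaining operators on `Y ⊕_∞ Z` -/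

theorem opNorm_le_of_closedUnitBall {𝕜 X : Type*} [RCLike 𝕜] [NormedAddCommGroup X]
    [NormedSpace 𝕜 X] {φ : StrongDual 𝕜 X} {c : ℝ} (h : ∀ x, ‖x‖ ≤ 1 → ‖φ x‖ ≤ c) : ‖φ‖ ≤ c := by
  have hc : 0 ≤ c := (norm_nonneg _).trans (h 0 (by simp))
  refine φ.opNorm_le_bound hc fun x => ?_
  rcases (norm_nonneg x).eq_or_lt with h0 | h0
  · rw [norm_eq_zero.1 h0.symm, map_zero, norm_zero, norm_zero, mul_zero]
  · have := h (((‖x‖⁻¹ : ℝ) : 𝕜) • x) (by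
      rw [norm_smul, RCLike.norm_ofReal, abs_of_pos (inv_pos.2 h0), inv_mul_cancel₀ h0.ne'])
    rwa [map_smul, norm_smul, RCLike.norm_ofReal, abs_of_pos (inv_pos.2 h0),
      inv_mul_le_iff₀ h0, mul_comm] at this

/-- The dual of a maximum norm is the sum of the dual norms; only this inequality is needed. -/
theorem norm_comp_inl_add_norm_comp_inr_le {𝕜 Y Z : Type*} [RCLike 𝕜] [NormedAddCommGroup Y]
    [NormedSpace 𝕜 Y] [NormedAddCommGroup Z] [NormedSpace 𝕜 Z] (χ : StrongDual 𝕜 (Y × Z)) :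
    ‖χ.comp (ContinuousLinearMap.inl 𝕜 Y Z)‖ + ‖χ.comp (ContinuousLinearMap.inr 𝕜 Y Z)‖ ≤ ‖χ‖ := by
  have key : ∀ y z, ‖y‖ ≤ 1 → ‖z‖ ≤ 1 → ‖χ (y, 0)‖ + ‖χ (0, z)‖ ≤ ‖χ‖ := by
    intro y z hy hz
    obtain ⟨c, hc, hc'⟩ := exists_rotation (χ (y, 0)) (χ (0, z))
    have e : χ (y, 0) + c * χ (0, z) = χ (y, c • z) := by
      rw [← smul_eq_mul, ← map_smul, ← map_add]
      simp
    rw [← hc', e]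
    refine (χ.le_opNorm _).trans (mul_le_of_le_one_right (norm_nonneg _) ?_)
    refine max_le hy ?_
    rw [norm_smul]
    exact mul_le_one₀ hc (norm_nonneg _) hz
  have h1 : ∀ z : Z, ‖z‖ ≤ 1 →
      ‖χ.comp (ContinuousLinearMap.inl 𝕜 Y Z)‖ ≤ ‖χ‖ - ‖χ (0, z)‖ := fun z hz =>
    opNorm_le_of_closedUnitBall fun y hy => le_sub_iff_add_le.2 (key y z hy hz)
  exact le_sub_iff_add_le'.1 (opNorm_le_of_closedUnitBall fun z hz => le_sub_comm.1 (h1 z hz))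

theorem norm_le_opNumericalRadius {𝕜 X : Type*} [RCLike 𝕜] [NormedAddCommGroup X] [NormedSpace 𝕜 X]
    (T : X →L[𝕜] X) {x : X} {χ : StrongDual 𝕜 X} (h : (x, χ) ∈ normingPairs 𝕜 X) :
    ‖χ (T x)‖ ≤ opNumericalRadius T := by
  refine le_csSup ⟨‖T‖, ?_⟩ ⟨_, ⟨(x, χ), h, rfl⟩, rfl⟩
  rintro _ ⟨_, ⟨⟨y, ψ⟩, ⟨hy, hψ, -⟩, rfl⟩, rfl⟩
  simp only at hy hψ ⊢
  calc ‖ψ (T y)‖ ≤ ‖ψ‖ * (‖T‖ * ‖y‖) := ψ.le_opNorm_of_le (T.le_opNorm y)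
    _ = ‖T‖ := by rw [hy, hψ, one_mul, mul_one]

section Sum

variable {𝕜 Y Z : Type*} [RCLike 𝕜] [NormedAddCommGroup Y] [NormedSpace 𝕜 Y]
  [NormedAddCommGroup Z] [NormedSpace 𝕜 Z]

theorem mem_normingPairs_comp_fst {y : Y} {z : Z} {φ : StrongDual 𝕜 Y} (hy : ‖y‖ ≤ 1)
    (hz : ‖z‖ ≤ 1) (hφ : ‖φ‖ = 1) (hφy : φ y = 1) :
    ((y, z), φ.comp (ContinuousLinearMap.fst 𝕜 Y Z)) ∈ normingPairs 𝕜 (Y × Z) := by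
  have hy1 : 1 ≤ ‖y‖ := by
    have := φ.le_opNorm y
    rwa [hφy, hφ, norm_one, one_mul] at this
  refine ⟨le_antisymm (max_le hy hz) (hy1.trans (le_max_left _ _)), le_antisymm ?_ ?_, hφy⟩
  · refine ContinuousLinearMap.opNorm_le_bound _ zero_le_one fun x => ?_
    refine (φ.le_opNorm_of_le (norm_fst_le x)).trans ?_
    rw [hφ]
  · rw [← hφ]
    refine φ.opNorm_le_bound (norm_nonneg _) fun x => ?_
    have := (φ.comp (ContinuousLinearMap.fst 𝕜 Y Z)).le_opNorm (x, 0)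
    simpa using this

theorem norm_apply_le_opNumericalRadius_mul (T : (Y × Z) →L[𝕜] (Y × Z)) {φ : StrongDual 𝕜 Y}
    (hφ : φ ≠ 0) {y : Y} {z : Z} (hy : ‖y‖ ≤ 1) (hz : ‖z‖ ≤ 1) (hφy : φ y = (‖φ‖ : 𝕜)) :
    ‖φ (T (y, z)).1‖ ≤ opNumericalRadius T * ‖φ‖ := by
  have h0 : 0 < ‖φ‖ := norm_pos_iff.2 hφ
  have hn : ‖((‖φ‖⁻¹ : ℝ) : 𝕜)‖ = ‖φ‖⁻¹ := by
    rw [RCLike.norm_ofReal, abs_of_pos (inv_pos.2 h0)]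
  have := norm_le_opNumericalRadius T (mem_normingPairs_comp_fst (Z := Z)
    (φ := ((‖φ‖⁻¹ : ℝ) : 𝕜) • φ) hy hz
    (by rw [norm_smul, hn, inv_mul_cancel₀ h0.ne'])
    (by rw [smul_apply, hφy, smul_eq_mul, ← RCLike.ofReal_mul, inv_mul_cancel₀ h0.ne',
          RCLike.ofReal_one]))
  change ‖((‖φ‖⁻¹ : ℝ) : 𝕜) • φ (T (y, z)).1‖ ≤ _ at this
  rwa [norm_smul, hn, inv_mul_le_iff₀ h0, mul_comm] at this

theorem norm_apply_fst_le_opNumericalRadius {j : StrongDual 𝕜 Y → Y} (hj : IsSmoothDualityMap j)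
    (T : (Y × Z) →L[𝕜] (Y × Z)) (φ : StrongDual 𝕜 Y) {z : Z} (hz : ‖z‖ ≤ 1) :
    ‖φ (T (j φ, z)).1‖ ≤ opNumericalRadius T * ‖φ‖ := by
  rcases eq_or_ne φ 0 with rfl | hφ
  · simp
  · refine norm_apply_le_opNumericalRadius_mul T hφ (hj.norm_le φ) hz (hj.apply_self φ)

/-- For an operator close to `liftToSum S`, a functional attaining the numerical radius cannot charge
the second summand, because the second component of `liftToSum S` vanishes. -/
theorem exists_attaining_functional_of_mem {S : Z →L[𝕜] Y}
    {T : (Y × Z) →L[𝕜] (Y × Z)} (hT : T ∈ numericalRadiusAttaining 𝕜 (Y × Z))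
    (hv : ‖T - liftToSum S‖ < opNumericalRadius T) :
    ∃ (y : Y) (z : Z) (φ : StrongDual 𝕜 Y), ‖y‖ ≤ 1 ∧ ‖z‖ ≤ 1 ∧ ‖φ‖ = 1 ∧ φ y = 1 ∧
      ‖φ (T (y, z)).1‖ = opNumericalRadius T := by
  obtain ⟨_, ⟨⟨⟨y, z⟩, χ⟩, ⟨hx, hχ, hχx⟩, rfl⟩, hval⟩ := hT
  simp only at hx hχ hχx hval
  set v := opNumericalRadius T
  set φ := χ.comp (ContinuousLinearMap.inl 𝕜 Y Z) with hφ
  set ζ := χ.comp (ContinuousLinearMap.inr 𝕜 Y Z) with hζ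
  have hy : ‖y‖ ≤ 1 := (le_max_left _ _).trans hx.le
  have hz : ‖z‖ ≤ 1 := (le_max_right _ _).trans hx.le
  have hsplit : ∀ x : Y × Z, χ x = φ x.1 + ζ x.2 := fun x => by
    rw [hφ, hζ]
    simp [← map_add]
  have hsum : ‖φ‖ + ‖ζ‖ ≤ 1 := (norm_comp_inl_add_norm_comp_inr_le χ).trans hχ.le
  have hφy : ‖φ y‖ ≤ ‖φ‖ :=
    (φ.le_opNorm y).trans (mul_le_of_le_one_right (norm_nonneg _) hy)
  have hζz : ‖ζ z‖ ≤ ‖ζ‖ :=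
    (ζ.le_opNorm z).trans (mul_le_of_le_one_right (norm_nonneg _) hz)
  have hre : RCLike.re (φ y) + RCLike.re (ζ z) = 1 := by
    rw [← map_add, ← hsplit (y, z), hχx, RCLike.one_re]
  have hreφ := RCLike.re_le_norm (φ y)
  have hreζ := RCLike.re_le_norm (ζ z)
  have hφy' : φ y = (‖φ‖ : 𝕜) := by
    rw [← RCLike.re_eq_self_of_le (show ‖φ y‖ ≤ RCLike.re (φ y) by linarith)]
    congr 1
    linarith
  -- the contribution of the second component of `T` is small
  have hsnd : ‖ζ (T (y, z)).2‖ ≤ ‖ζ‖ * ‖T - liftToSum S‖ := by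
    refine ζ.le_opNorm_of_le ?_
    have e : (T (y, z)).2 = ((T - liftToSum S) (y, z)).2 := by
      simp [liftToSum]
    rw [e]
    refine (norm_snd_le _).trans (((T - liftToSum S).le_opNorm _).trans ?_)
    rw [hx, mul_one]
  have hfst : ‖φ (T (y, z)).1‖ ≤ v * ‖φ‖ := by
    rcases eq_or_ne φ 0 with h0 | h0
    · rw [h0]; simp
    · exact norm_apply_le_opNumericalRadius_mul T h0 hy hz hφy'
  have hv0 : 0 < v := (norm_nonneg _).trans_lt hv
  have hle : v ≤ v * ‖φ‖ + ‖ζ‖ * ‖T - liftToSum S‖ := by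
    calc v = ‖φ (T (y, z)).1 + ζ (T (y, z)).2‖ := by rw [← hsplit, hval]
      _ ≤ _ := (norm_add_le _ _).trans (add_le_add hfst hsnd)
  have hζ0 : ‖ζ‖ = 0 := by
    by_contra hne
    have hpos : 0 < ‖ζ‖ := lt_of_le_of_ne (norm_nonneg _) (Ne.symm hne)
    nlinarith [mul_pos hpos (sub_pos.2 hv)]
  have hφ1 : ‖φ‖ = 1 := by linarith
  refine ⟨y, z, φ, hy, hz, hφ1, by rw [hφy', hφ1, RCLike.ofReal_one], ?_⟩
  rw [← hval, hsplit, norm_eq_zero.1 hζ0]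
  simp

end Sum

theorem comp_inr_mem_finiteRankOperators {𝕜 Y : Type*} [RCLike 𝕜] [NormedAddCommGroup Y]
    [NormedSpace 𝕜 Y] {j : StrongDual 𝕜 Y → Y} (hj : IsSmoothDualityMap j)
    {Z : Submodule 𝕜 C₀(ℕ, 𝕜)} {S : Z →L[𝕜] Y} {T : (Y × Z) →L[𝕜] (Y × Z)}
    (hT : T ∈ numericalRadiusAttaining 𝕜 (Y × Z)) (hv : ‖T - liftToSum S‖ < opNumericalRadius T) :
    (ContinuousLinearMap.fst 𝕜 Y Z).comp (T.comp (ContinuousLinearMap.inr 𝕜 Y Z)) ∈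
      finiteRankOperators 𝕜 Z Y := by
  obtain ⟨y, z, φ, hy, hz, hφ, hφy, hval⟩ := exists_attaining_functional_of_mem hT hv
  have hφ0 : φ ≠ 0 := by rintro rfl; simp at hφ
  obtain rfl : y = j φ := hj.eq_of_apply_eq_norm hφ0 hy (by rw [hφy, hφ, RCLike.ofReal_one])
  have hsplit : ∀ (y : Y) (z : Z), (T (y, z)).1 =
      ((ContinuousLinearMap.fst 𝕜 Y Z).comp (T.comp (ContinuousLinearMap.inl 𝕜 Y Z))) y +
      ((ContinuousLinearMap.fst 𝕜 Y Z).comp (T.comp (ContinuousLinearMap.inr 𝕜 Y Z))) z := by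
    intro y z
    have : ((y, z) : Y × Z) = (y, 0) + (0, z) := by simp
    rw [this, map_add]
    rfl
  rw [hsplit] at hval
  refine mem_finiteRankOperators_of_isMax hj _ _ ((norm_nonneg _).trans_lt hv) (fun ψ w hw => ?_)
    hφ hz hval
  rw [← hsplit]
  exact norm_apply_fst_le_opNumericalRadius hj T ψ hw

section Perturbation

variable {𝕜 Y Z : Type*} [RCLike 𝕜] [NormedAddCommGroup Y] [NormedSpace 𝕜 Y]
  [NormedAddCommGroup Z] [NormedSpace 𝕜 Z]

theorem norm_fst_apply_sub_le (T : (Y × Z) →L[𝕜] (Y × Z)) (S : Z →L[𝕜] Y) (x : Y × Z) :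
    ‖(T x).1 - S x.2‖ ≤ ‖T - liftToSum S‖ * ‖x‖ := by
  have e : (T x).1 - S x.2 = ((T - liftToSum S) x).1 := by
    simp [liftToSum]
  rw [e]
  exact (norm_fst_le _).trans ((T - liftToSum S).le_opNorm _)

theorem lt_opNumericalRadius_of_norm_sub_liftToSum_lt {j : StrongDual 𝕜 Y → Y}
    (hj : IsSmoothDualityMap j) {T : (Y × Z) →L[𝕜] (Y × Z)} {S : Z →L[𝕜] Y} {z : Z}
    (hz : ‖z‖ ≤ 1) (hS : S z ≠ 0) (hT : ‖T - liftToSum S‖ < ‖S z‖ / 2) :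
    ‖T - liftToSum S‖ < opNumericalRadius T := by
  obtain ⟨φ, hφ, hφS⟩ := exists_dual_vector 𝕜 (S z) (norm_ne_zero_iff.2 hS)
  have h1 := norm_apply_fst_le_opNumericalRadius hj T φ hz
  rw [hφ, mul_one] at h1
  have h2 := φ.le_opNorm_of_le ((norm_fst_apply_sub_le T S (j φ, z)).trans
    (mul_le_of_le_one_right (norm_nonneg _) (max_le (hj.norm_le φ) hz)))
  rw [hφ, one_mul, map_sub, hφS] at h2
  have h3 := norm_sub_le (φ (T (j φ, z)).1) (φ (T (j φ, z)).1 - (‖S z‖ : 𝕜))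
  rw [sub_sub_cancel, RCLike.norm_ofReal, abs_norm] at h3
  linarith

theorem norm_sub_fst_comp_inr_le (T : (Y × Z) →L[𝕜] (Y × Z)) (S : Z →L[𝕜] Y) :
    ‖S - (ContinuousLinearMap.fst 𝕜 Y Z).comp (T.comp (ContinuousLinearMap.inr 𝕜 Y Z))‖ ≤
      ‖T - liftToSum S‖ := by
  rw [norm_sub_rev]
  refine ContinuousLinearMap.opNorm_le_bound _ (norm_nonneg _) fun w => ?_
  simpa using norm_fst_apply_sub_le T S (0, w)

end Perturbation

/-- Numerical radius attaining operators near `liftToSum S` have an entry `Z → Y` of finite rank, and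
this entry is close to `S`. -/
theorem liftToSum_notMem_closure_numericalRadiusAttaining {𝕜 Y : Type*} [RCLike 𝕜]
    [NormedAddCommGroup Y] [NormedSpace 𝕜 Y] {j : StrongDual 𝕜 Y → Y} (hj : IsSmoothDualityMap j)
    {Z : Submodule 𝕜 C₀(ℕ, 𝕜)} {S : Z →L[𝕜] Y} (hS : S ∉ closure (finiteRankOperators 𝕜 Z Y)) :
    liftToSum S ∉ closure (numericalRadiusAttaining 𝕜 (Y × Z)) := by
  intro hcl
  obtain ⟨z, hz, hSz⟩ : ∃ z : Z, ‖z‖ ≤ 1 ∧ S z ≠ 0 := by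
    by_contra! h
    refine hS (subset_closure ?_)
    refine mem_finiteRankOperators_of_ker_le S (0 : Z →ₗ[𝕜] 𝕜) fun z _ => ?_
    by_cases hz : z = 0
    · rw [hz, map_zero]
    have hz' : 0 < ‖z‖ := norm_pos_iff.2 hz
    have := h (((‖z‖⁻¹ : ℝ) : 𝕜) • z) (by
      rw [norm_smul, RCLike.norm_ofReal, abs_of_pos (inv_pos.2 hz'), inv_mul_cancel₀ hz'.ne'])
    rw [map_smul] at this
    exact (smul_eq_zero.1 this).resolve_left
      (RCLike.ofReal_ne_zero.2 (inv_ne_zero hz'.ne'))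
  refine hS (Metric.mem_closure_iff.2 fun ε hε => ?_)
  have hs : 0 < ‖S z‖ := norm_pos_iff.2 hSz
  obtain ⟨T, hT, hTS⟩ := Metric.mem_closure_iff.1 hcl (min ε (‖S z‖ / 2))
    (lt_min hε (half_pos hs))
  rw [dist_comm, dist_eq_norm, lt_min_iff] at hTS
  refine ⟨_, comp_inr_mem_finiteRankOperators hj hT
    (lt_opNumericalRadius_of_norm_sub_liftToSum_lt hj hz hSz hTS.2), ?_⟩
  rw [dist_eq_norm]
  exact (norm_sub_fst_comp_inr_le T S).trans_lt hTS.1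

theorem isCompactOperator_liftToSum {𝕜 Y Z : Type*} [RCLike 𝕜] [NormedAddCommGroup Y]
    [NormedSpace 𝕜 Y] [NormedAddCommGroup Z] [NormedSpace 𝕜 Z] {S : Z →L[𝕜] Y}
    (hS : IsCompactOperator S) : IsCompactOperator (liftToSum S) :=
  (hS.comp_clm (ContinuousLinearMap.snd 𝕜 Y Z)).clm_comp (ContinuousLinearMap.inl 𝕜 Y Z)

theorem mainTheorem2 {𝕜 : Type*} [RCLike 𝕜] (p : ℝ≥0∞) [Fact (1 ≤ p)] (hp₁ : 1 < p) (hp₂ : p < 2)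
    (M : Submodule 𝕜 (lp (fun _ : ℕ => 𝕜) p)) [IsClosed (M : Set (lp (fun _ : ℕ => 𝕜) p))]
    {Y : Type*} [NormedAddCommGroup Y] [NormedSpace 𝕜 Y]
    (e : Y ≃ₗᵢ[𝕜] (lp (fun _ : ℕ => 𝕜) p ⧸ M))
    (hY : ¬ HasApproximationProperty 𝕜 Y) :
    ∃ Z : Submodule 𝕜 C₀(ℕ, 𝕜), IsClosed (Z : Set C₀(ℕ, 𝕜)) ∧
      ¬ ({T : (Y × Z) →L[𝕜] (Y × Z) | IsCompactOperator T} ⊆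
          closure (numericalRadiusAttaining 𝕜 (Y × Z))) ∧
      ∃ S : Z →L[𝕜] Y,
        IsCompactOperator S ∧
        S ∉ closure (finiteRankOperators 𝕜 Z Y) ∧
        IsCompactOperator (liftToSum S) ∧
        liftToSum S ∉ closure (numericalRadiusAttaining 𝕜 (Y × Z)) := by
  have : CompleteSpace Y := 
    (completeSpace_congr (e := e.toEquiv) e.isometry.isUniformEmbedding).2 inferInstance
  obtain ⟨j, hj⟩ := exists_smoothDualityMap_quotient_lp hp₁ hp₂ M e
  obtain ⟨Z, hZ, S, hSc, hSf⟩ := exists_compact_operator_not_mem_closure_finiteRank hY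
  have hT := liftToSum_notMem_closure_numericalRadiusAttaining hj hSf
  have hTc := isCompactOperator_liftToSum hSc
  exact ⟨Z, hZ, fun h => hT (h hTc), S, hSc, hSf, hTc, hT⟩
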